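/- Let $X$ be a closed (compact, without boundary) smooth three-manifold with a contact metric structure $(\phi,\xi,\kappa,g)$ (for instance a quasi-regular K-contact structure): $\kappa\in\Omega^1(X)$ is a contact form with Reeb field $\xi$ (so $\kappa(\xi)=1$, $\iota_\xi d\kappa=0$), $H=\ker\kappa$, $\phi\in\mathrm{End}(TX)$ satisfies $\phi(\xi)=0$ and restricts to a complex structure on $H$, and $g=\kappa\otimes\kappa+d\kappa(\cdot,\phi\,\cdot)$ is a Riemannian metric. Orient $X$ by $\kappa\wedge d\kappa$, and let $\star$ be the Hodge star of $g$, normalized by $\star 1=\kappa\wedge d\kappa$. A form is horizontal if it is annihilated by $\iota_\xi$; $\Omega^\bullet(H)$ denotes the horizontal forms. Put $\star_H=\iota_\xi\circ\star$, let $d_H\omega$ be the horizontal part of $d\omega$ (the restriction of $d\omega$ to $H$), and for $A\in\Omega^1(H)$ let $$D^1A=(\mathcal L_\xi+d_H\star_H d_H)A,\qquad DA=\kappa\wedge D^1A .$$ For one-forms let $\langle\alpha,\beta\rangle=\int_X\alpha\wedge\star\beta$ be the $L^2$ inner product, and for $\alpha,\beta\in\Omega^1(H)$ let $\langle\alpha,\beta\rangle^1_\kappa=-\int_X\kappa\wedge(\alpha\wedge\star_H\beta)$.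 For $A\in\Omega^1(X)$ define $$S(A)=\int_X A\wedge dA-\int_X\frac{(\kappa\wedge dA)^2}{\kappa\wedge d\kappa},$$ where $\frac{(\kappa\wedge dA)^2}{\kappa\wedge d\kappa}:=f\,\kappa\wedge dA$ for the function $f$ with $\kappa\wedge dA=f\,\kappa\wedge d\kappa$. Then: 1. $S$ is shift-invariant: $S(A+\sigma\kappa)=S(A)$ for all $A\in\Omega^1(X)$ and $\sigma\in C^\infty(X)$. 2. For every $A\in\Omega^1(H)$, $$S(A)=\langle A,\star DA\rangle=\langle A,-\star_H D^1A\rangle^1_\kappa .$$ 3. $D$ is Rumin's contact operator: for every $A\in\Omega^1(H)$ there is exactly one $l(A)\in\Omega^1(X)$ that agrees with $A$ on $H$ and satisfies $\kappa\wedge d\,l(A)=0$, and $DA=d\,l(A)$. -/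

import Mathlib

open scoped Manifold ContDiff

noncomputable section

namespace ContactCS

/-- The model space of three-manifolds. -/
abbrev E3 : Type := EuclideanSpace ℝ (Fin 3)

/-- The standard frame of the model space. -/
def stdFrame (i : Fin 3) : E3 := EuclideanSpace.single i (1 : ℝ)

/-! ### Exterior algebra on one tangent space -/

section Pointwise

variable {V : Type*} [NormedAddCommGroup V] [NormedSpace ℝ V]

/-- The wedge product `α ∧ η` of a one-form with a `k`-form,
`(α ∧ η) (v₀, …, v_k) = ∑ i, (-1)^i α (v_i) η (v₀, …, v̂_i, …, v_k)`. -/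
def wedgeOne {k : ℕ} (α : V [⋀^Fin 1]→L[ℝ] ℝ) (η : V [⋀^Fin k]→L[ℝ] ℝ) :
    V [⋀^Fin (k + 1)]→L[ℝ] ℝ :=
  ContinuousAlternatingMap.alternatizeUncurryFin
    (((ContinuousAlternatingMap.ofSubsingleton ℝ V ℝ (0 : Fin 1)).symm α).smulRight η)

/-- The contraction `η (v₀, …, v_{k-1}, ·, …, ·)`. -/
def contract {m : ℕ} : (k : ℕ) → (Fin k → V) → V [⋀^Fin (m + k)]→L[ℝ] ℝ → V [⋀^Fin m]→L[ℝ] ℝ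
  | 0, _, η => η
  | k + 1, v, η => contract k (fun i => v i.succ) (η.curryLeft (v 0))

/-- `e` is an orthonormal basis for the bilinear form `g`. -/
def IsOrthonormalFrame (g : V → V → ℝ) (e : Module.Basis (Fin 3) ℝ V) : Prop :=
  ∀ i j, g (e i) (e j) = if i = j then 1 else 0

open Classical in
/-- The Hodge star `⋆ : Λ^k → Λ^m`, `m + k = 3`, of a three-dimensional Euclidean space with inner
product `g` and volume form `vol`:
`⋆β = (1/k!) ∑ β (e_{i₁}, …, e_{i_k}) vol (e_{i₁}, …, e_{i_k}, ·, …, ·)`, the sum being over all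
`k`-tuples of members of an orthonormal basis `e` (it does not depend on the basis). -/
def hodgeStar (g : V → V → ℝ) {k m : ℕ} (vol : V [⋀^Fin (m + k)]→L[ℝ] ℝ)
    (β : V [⋀^Fin k]→L[ℝ] ℝ) : V [⋀^Fin m]→L[ℝ] ℝ :=
  if h : ∃ e : Module.Basis (Fin 3) ℝ V, IsOrthonormalFrame g e then
    ((k.factorial : ℝ)⁻¹) • ∑ f : Fin k → Fin 3,
      β (fun a => h.choose (f a)) • contract k (fun a => h.choose (f a)) vol
  else 0

end Pointwise

/-! ### Differential forms on a three-manifold -/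

section Manifold

variable {X : Type*} [TopologicalSpace X] [ChartedSpace E3 X]

variable (X) in
/-- (Not necessarily smooth) differential `k`-forms. The tangent space `TangentSpace (𝓡 3) x` of
Mathlib is by definition the model space `E3`, for every point `x`. -/
abbrev DiffForm (k : ℕ) : Type _ := X → E3 [⋀^Fin k]→L[ℝ] ℝ

/-- Differential at `p` of the preferred chart around `x₀`. -/
def chartD (x₀ p : X) : E3 →L[ℝ] E3 :=
  mfderiv (𝓡 3) 𝓘(ℝ, E3) (extChartAt (𝓡 3) x₀) p

/-- Differential at `y` of the inverse of the preferred chart around `x₀`. -/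
def chartSymmD (x₀ : X) (y : E3) : E3 →L[ℝ] E3 :=
  mfderiv 𝓘(ℝ, E3) (𝓡 3) (extChartAt (𝓡 3) x₀).symm y

/-- Coordinate expression of a form in the chart around `x₀`: its pullback under the inverse
chart. -/
def formRep {k : ℕ} (η : DiffForm X k) (x₀ : X) (y : E3) : E3 [⋀^Fin k]→L[ℝ] ℝ :=
  (η ((extChartAt (𝓡 3) x₀).symm y)).compContinuousLinearMap (chartSymmD x₀ y)

/-- Coordinate expression of a vector field in the chart around `x₀`. -/
def fieldRep (w : X → E3) (x₀ : X) (y : E3) : E3 :=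
  chartD x₀ ((extChartAt (𝓡 3) x₀).symm y) (w ((extChartAt (𝓡 3) x₀).symm y))

/-- Coordinate expression of an endomorphism field of the tangent bundle in the chart around
`x₀`. -/
def endoRep (φ : X → E3 →L[ℝ] E3) (x₀ : X) (y : E3) : E3 →L[ℝ] E3 :=
  (chartD x₀ ((extChartAt (𝓡 3) x₀).symm y)).comp
    ((φ ((extChartAt (𝓡 3) x₀).symm y)).comp (chartSymmD x₀ y))

/-- A form is smooth if its coordinate expressions are. -/
def IsSmoothForm {k : ℕ} (η : DiffForm X k) : Prop :=
  ∀ x₀ : X, ContDiffOn ℝ ∞ (formRep η x₀) (extChartAt (𝓡 3) x₀).target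

/-- A vector field is smooth if its coordinate expressions are. -/
def IsSmoothField (w : X → E3) : Prop :=
  ∀ x₀ : X, ContDiffOn ℝ ∞ (fieldRep w x₀) (extChartAt (𝓡 3) x₀).target

/-- An endomorphism field is smooth if its coordinate expressions are. -/
def IsSmoothEndo (φ : X → E3 →L[ℝ] E3) : Prop :=
  ∀ x₀ : X, ContDiffOn ℝ ∞ (endoRep φ x₀) (extChartAt (𝓡 3) x₀).target

/-- The exterior derivative, computed at `x` in the chart around `x`. -/
def extD {k : ℕ} (η : DiffForm X k) : DiffForm X (k + 1) := fun x =>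
  (extDeriv (formRep η x) (extChartAt (𝓡 3) x x)).compContinuousLinearMap (chartD x x)

/-- The Lie derivative of a one-form along a vector field, computed at `x` in the chart around `x`:
`(L_w α)_i = w^j ∂_j α_i + α_j ∂_i w^j`. -/
def lieD (w : X → E3) (α : DiffForm X 1) : DiffForm X 1 := fun x =>
  (fderiv ℝ (formRep α x) (extChartAt (𝓡 3) x x) (fieldRep w x (extChartAt (𝓡 3) x x)) +
    (formRep α x (extChartAt (𝓡 3) x x)).compContinuousLinearMap
      (fderiv ℝ (fieldRep w x) (extChartAt (𝓡 3) x x))).compContinuousLinearMap (chartD x x)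

/-- Wedge product of a one-form with a form. -/
def wedge {k : ℕ} (α : DiffForm X 1) (η : DiffForm X k) : DiffForm X (k + 1) :=
  fun x => wedgeOne (α x) (η x)

/-- Product of a function with a form. -/
def smulForm {k : ℕ} (f : X → ℝ) (η : DiffForm X k) : DiffForm X k := fun x => f x • η x

/-- Interior product with a vector field. -/
def interior {k : ℕ} (w : X → E3) (η : DiffForm X (k + 1)) : DiffForm X k :=
  fun x => (η x).curryLeft (w x)

/-- The quotient `η / μ` of a three-form by a nowhere vanishing three-form: the function `f` with
`η = f μ`. -/
def quot (η μ : DiffForm X 3) (x : X) : ℝ := η x stdFrame / μ x stdFrame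

/-! ### Integration -/

section Integration

variable [IsManifold (𝓡 3) ∞ X] [CompactSpace X] [T2Space X]

variable (X) in
/-- A smooth partition of unity subordinate to the cover by the domains of the preferred charts. -/
def partUnity : SmoothPartitionOfUnity X (𝓡 3) X Set.univ :=
  (SmoothPartitionOfUnity.exists_isSubordinate_chartAt_source (I := 𝓡 3) X).choose

variable (X) in
theorem partUnity_isSubordinate :
    (partUnity X).IsSubordinate (fun x => (chartAt E3 x).source) :=
  (SmoothPartitionOfUnity.exists_isSubordinate_chartAt_source (I := 𝓡 3) X).choose_spec

/-- The integral of the three-form `η` over the closed manifold `X`, oriented by the nowhere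
vanishing three-form `μ`: cut `η` with a partition of unity and integrate the pieces in the charts,
with a sign that compares the orientation of the chart with that given by `μ`. -/
def integral (μ η : DiffForm X 3) : ℝ :=
  ∑ᶠ i : X, ∫ y in (extChartAt (𝓡 3) i).target,
    Real.sign (formRep μ i y stdFrame) *
      (partUnity X i ((extChartAt (𝓡 3) i).symm y) * formRep η i y stdFrame)

end Integration

/-! ### Contact metric structures -/

variable (X) in
/-- A contact metric structure `(φ, ξ, κ, g)` on a three-manifold: `κ` is a contact form, `ξ` its
Reeb field, `φ` vanishes on `ξ` and is a complex structure on `H = ker κ`, and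
`g = κ ⊗ κ + dκ(·, φ ·)` is a Riemannian metric. -/
structure ContactMetricStructure where
  κ : DiffForm X 1
  ξ : X → E3
  φ : X → E3 →L[ℝ] E3
  smooth_κ : IsSmoothForm κ
  smooth_ξ : IsSmoothField ξ
  smooth_φ : IsSmoothEndo φ
  contact : ∀ x, wedge κ (extD κ) x ≠ 0
  κ_ξ : ∀ x, κ x ![ξ x] = 1
  dκ_ξ : ∀ x (v : E3), extD κ x ![ξ x, v] = 0
  φ_ξ : ∀ x, φ x (ξ x) = 0
  φ_horizontal : ∀ x (v : E3), κ x ![v] = 0 → κ x ![φ x v] = 0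
  φ_sq : ∀ x (v : E3), κ x ![v] = 0 → φ x (φ x v) = -v
  metric_symm : ∀ x (u v : E3),
    κ x ![u] * κ x ![v] + extD κ x ![u, φ x v] = κ x ![v] * κ x ![u] + extD κ x ![v, φ x u]
  metric_pos : ∀ x (v : E3), v ≠ 0 → 0 < κ x ![v] * κ x ![v] + extD κ x ![v, φ x v]

namespace ContactMetricStructure

variable (M : ContactMetricStructure X)

/-- The metric `g = κ ⊗ κ + dκ(·, φ ·)`. -/
def g (x : X) (u v : E3) : ℝ := M.κ x ![u] * M.κ x ![v] + extD M.κ x ![u, M.φ x v]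

/-- The volume form `κ ∧ dκ`, which also orients the manifold. -/
def vol : DiffForm X 3 := wedge M.κ (extD M.κ)

/-- The form lies in `Ω^1(H)`, that is, `ι_ξ A = 0`. -/
def IsHorizontal (A : DiffForm X 1) : Prop := ∀ x, A x ![M.ξ x] = 0

/-- The projection of the tangent space onto `H = ker κ` along `ξ`. -/
def projH (x : X) : E3 →L[ℝ] E3 :=
  ContinuousLinearMap.id ℝ E3 -
    ((ContinuousAlternatingMap.ofSubsingleton ℝ E3 ℝ (0 : Fin 1)).symm (M.κ x)).smulRight (M.ξ x)

/-- The horizontal exterior derivative: the restriction of `dη` to `H`, regarded as a horizontal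
form. -/
def dH {k : ℕ} (η : DiffForm X k) : DiffForm X (k + 1) :=
  fun x => (extD η x).compContinuousLinearMap (M.projH x)

/-- The Hodge star of `g` on one-forms, normalized by `⋆1 = κ ∧ dκ`. -/
def star₁ (β : DiffForm X 1) : DiffForm X 2 :=
  fun x => hodgeStar (M.g x) (k := 1) (m := 2) (M.vol x) (β x)

/-- The Hodge star of `g` on two-forms, normalized by `⋆1 = κ ∧ dκ`. -/
def star₂ (β : DiffForm X 2) : DiffForm X 1 :=
  fun x => hodgeStar (M.g x) (k := 2) (m := 1) (M.vol x) (β x)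

/-- The horizontal star `⋆_H = ι_ξ ∘ ⋆` on one-forms. -/
def starH₁ (β : DiffForm X 1) : DiffForm X 1 := interior M.ξ (M.star₁ β)

/-- The horizontal star `⋆_H = ι_ξ ∘ ⋆` on two-forms. -/
def starH₂ (β : DiffForm X 2) : DiffForm X 0 := interior M.ξ (M.star₂ β)

/-- `D¹ = L_ξ + d_H ⋆_H d_H` on one-forms. -/
def D1 (A : DiffForm X 1) : DiffForm X 1 := lieD M.ξ A + M.dH (M.starH₂ (M.dH A))

/-- The contact operator `D = κ ∧ (L_ξ + d_H ⋆_H d_H)`. -/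
def D (A : DiffForm X 1) : DiffForm X 2 := wedge M.κ (M.D1 A)

/-- `l` is a smooth one-form that agrees with `A` on `H` and whose differential is vertical:
`κ ∧ dl = 0`. -/
def IsRuminLift (A l : DiffForm X 1) : Prop :=
  IsSmoothForm l ∧ (∀ x (v : E3), M.κ x ![v] = 0 → l x ![v] = A x ![v]) ∧
    wedge M.κ (extD l) = 0

section Integrals

variable [IsManifold (𝓡 3) ∞ X] [CompactSpace X] [T2Space X]

/-- The action `S(A) = ∫ A ∧ dA - ∫ (κ ∧ dA)² / (κ ∧ dκ)`, where `(κ ∧ dA)² / (κ ∧ dκ)` is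
`f (κ ∧ dA)` for the function `f` with `κ ∧ dA = f (κ ∧ dκ)`. -/
def action (A : DiffForm X 1) : ℝ :=
  integral M.vol (wedge A (extD A)) -
    integral M.vol (smulForm (quot (wedge M.κ (extD A)) (wedge M.κ (extD M.κ)))
      (wedge M.κ (extD A)))

/-- The `L²` inner product `⟨α, β⟩ = ∫ α ∧ ⋆β` on one-forms. -/
def inner (α β : DiffForm X 1) : ℝ := integral M.vol (wedge α (M.star₁ β))

/-- The pairing `⟨α, β⟩_κ = -∫ κ ∧ (α ∧ ⋆_H β)` on horizontal one-forms. -/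
def innerκ (α β : DiffForm X 1) : ℝ := -integral M.vol (wedge M.κ (wedge α (M.starH₁ β)))

end Integrals

end ContactMetricStructure

end Manifold

end ContactCS

end

noncomputable section
namespace ContactCS

/-! ### Wedge products and exterior derivatives in low degree -/

section Pointwise

variable {V : Type*} [NormedAddCommGroup V] [NormedSpace ℝ V]

/-! Write `κ ∧ dA = f κ ∧ dκ`. Since `κ ∧ d(σκ) = σ κ ∧ dκ`, replacing `A` by `A + σκ` replaces `f`
by `f + σ`. Hence `l(A) = A - fκ` is the only shift with `κ ∧ dl = 0`; this is Rumin's lift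
(`isRuminLift_ruminLift`, `eq_ruminLift`).

Under the shift by `σκ` the integrand of the action changes by `-d(σA ∧ κ)`, so Stokes' theorem
(`integral_extD`) gives shift-invariance. Applied with `σ = -f` it gives `S(A) = S(l(A))`, where the
quadratic term vanishes; as `κ ∧ dl(A) = 0`, what remains is `∫ A ∧ dl(A)` (`action_eq_integral`).

The equality `DA = dl(A)` is pointwise (`D_eq_extD_ruminLift`): Cartan's formula and `⋆_H d_H A = f`
give `D¹A = ι_ξ dA + d_H f`, and contracting `κ ∧ dA = f κ ∧ dκ` with `ξ` gives `κ ∧ ι_ξ dA = dA - f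
dκ`. The two pairings then follow from `⋆⋆ = 1` on two-forms (`star₁_star₂`) and `⋆_H² = -1` on
horizontal one-forms (`starH₁_neg_starH₁`). Both rest on `κ ∧ dκ` being `±1` on orthonormal frames
(`vol_frame_sq`), a consequence of the contact metric axioms.

Stokes' theorem is proved by hand for the partition-of-unity integral: `formRep_extD` makes `d`
independent of the chart, and `chartIntegral_congr_chart` does the same for the integral. -/

theorem ofSubsingleton_symm_apply (α : V [⋀^Fin 1]→L[ℝ] ℝ) (v : V) :
    (ContinuousAlternatingMap.ofSubsingleton ℝ V ℝ (0 : Fin 1)).symm α v = α ![v] := by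
  change α _ = α _
  congr 1
  ext j
  simp

theorem wedgeOne_apply {k : ℕ} (α : V [⋀^Fin 1]→L[ℝ] ℝ) (η : V [⋀^Fin k]→L[ℝ] ℝ)
    (v : Fin (k + 1) → V) :
    wedgeOne α η v = ∑ i : Fin (k + 1), (-1) ^ (i : ℕ) * (α ![v i] * η (i.removeNth v)) := by
  rw [wedgeOne, ContinuousAlternatingMap.alternatizeUncurryFin_apply]
  refine Finset.sum_congr rfl fun i _ => ?_
  rw [ContinuousLinearMap.smulRight_apply, ofSubsingleton_symm_apply]
  simp

theorem wedgeOne_apply₂ (α η : V [⋀^Fin 1]→L[ℝ] ℝ) (u v : V) :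
    wedgeOne α η ![u, v] = α ![u] * η ![v] - α ![v] * η ![u] := by
  rw [wedgeOne_apply]
  have h0 : (0 : Fin 2).removeNth ![u, v] = ![v] := by ext i; fin_cases i; rfl
  have h1 : (1 : Fin 2).removeNth ![u, v] = ![u] := by ext i; fin_cases i; rfl
  simp [Fin.sum_univ_two, h0, h1]
  ring

theorem wedgeOne_apply₃ (α : V [⋀^Fin 1]→L[ℝ] ℝ) (η : V [⋀^Fin 2]→L[ℝ] ℝ) (u v w : V) :
    wedgeOne α η ![u, v, w] =
      α ![u] * η ![v, w] - α ![v] * η ![u, w] + α ![w] * η ![u, v] := by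
  rw [wedgeOne_apply]
  have h0 : (0 : Fin 3).removeNth ![u, v, w] = ![v, w] := by ext i; fin_cases i <;> rfl
  have h1 : (1 : Fin 3).removeNth ![u, v, w] = ![u, w] := by ext i; fin_cases i <;> rfl
  have h2 : (2 : Fin 3).removeNth ![u, v, w] = ![u, v] := by ext i; fin_cases i <;> rfl
  simp [Fin.sum_univ_three, h0, h1, h2]
  ring

theorem wedgeOne_compContinuousLinearMap {W : Type*} [NormedAddCommGroup W] [NormedSpace ℝ W]
    {k : ℕ} (α : V [⋀^Fin 1]→L[ℝ] ℝ) (η : V [⋀^Fin k]→L[ℝ] ℝ) (L : W →L[ℝ] V) :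
    (wedgeOne α η).compContinuousLinearMap L =
      wedgeOne (α.compContinuousLinearMap L) (η.compContinuousLinearMap L) := by
  ext v
  simp only [ContinuousAlternatingMap.compContinuousLinearMap_apply, wedgeOne_apply]
  refine Finset.sum_congr rfl fun i _ => ?_
  congr 3
  ext j
  simp

theorem contDiffOn_wedgeOne {k : ℕ} {n : ℕ∞ω} {s : Set V} {α : V → V [⋀^Fin 1]→L[ℝ] ℝ}
    {η : V → V [⋀^Fin k]→L[ℝ] ℝ} (hα : ContDiffOn ℝ n α s) (hη : ContDiffOn ℝ n η s) :
    ContDiffOn ℝ n (fun y => wedgeOne (α y) (η y)) s := by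
  have h1 : ContDiffOn ℝ n (fun y =>
      (ContinuousAlternatingMap.ofSubsingletonLIE (𝕜 := ℝ) (E := V) (F := ℝ) (0 : Fin 1)).symm
        (α y)) s :=
    (LinearIsometryEquiv.contDiff _).comp_contDiffOn hα
  exact (ContinuousAlternatingMap.alternatizeUncurryFinCLM ℝ V ℝ).contDiff.comp_contDiffOn
    (h1.smulRight hη)

theorem extDeriv_apply₂ {η : V → V [⋀^Fin 1]→L[ℝ] ℝ} {x : V} (h : DifferentiableAt ℝ η x)
    (u v : V) :
    extDeriv η x ![u, v] = fderiv ℝ η x u ![v] - fderiv ℝ η x v ![u] := by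
  rw [extDeriv_apply h]
  simp only [fderiv_continuousAlternatingMap_apply_const_apply h]
  have h0 : (0 : Fin 2).removeNth ![u, v] = ![v] := by ext i; fin_cases i; rfl
  have h1 : (1 : Fin 2).removeNth ![u, v] = ![u] := by ext i; fin_cases i; rfl
  simp [Fin.sum_univ_two, h0, h1]
  ring

theorem extDeriv_apply₃ {η : V → V [⋀^Fin 2]→L[ℝ] ℝ} {x : V} (h : DifferentiableAt ℝ η x)
    (u v w : V) :
    extDeriv η x ![u, v, w] =
      fderiv ℝ η x u ![v, w] - fderiv ℝ η x v ![u, w] + fderiv ℝ η x w ![u, v] := by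
  rw [extDeriv_apply h]
  simp only [fderiv_continuousAlternatingMap_apply_const_apply h]
  have h0 : (0 : Fin 3).removeNth ![u, v, w] = ![v, w] := by ext i; fin_cases i <;> rfl
  have h1 : (1 : Fin 3).removeNth ![u, v, w] = ![u, w] := by ext i; fin_cases i <;> rfl
  have h2 : (2 : Fin 3).removeNth ![u, v, w] = ![u, v] := by ext i; fin_cases i <;> rfl
  simp [Fin.sum_univ_three, h0, h1, h2]
  ring

/-- Forms that agree on all triples written as `![u, v, w]` are equal. -/
theorem ext₃ {η θ : V [⋀^Fin 3]→L[ℝ] ℝ} (h : ∀ u v w, η ![u, v, w] = θ ![u, v, w]) : η = θ := by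
  ext v
  have hv : v = ![v 0, v 1, v 2] := by ext i; fin_cases i <;> rfl
  rw [hv]
  exact h _ _ _

theorem ext₂ {η θ : V [⋀^Fin 2]→L[ℝ] ℝ} (h : ∀ u v, η ![u, v] = θ ![u, v]) : η = θ := by
  ext v
  have hv : v = ![v 0, v 1] := by ext i; fin_cases i <;> rfl
  rw [hv]
  exact h _ _

theorem ext₁ {η θ : V [⋀^Fin 1]→L[ℝ] ℝ} (h : ∀ u, η ![u] = θ ![u]) : η = θ := by
  ext v
  have hv : v = ![v 0] := by ext i; fin_cases i; rfl
  rw [hv]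
  exact h _

end Pointwise

/-! ### Coordinate expressions and independence of the chart -/

section Charts

variable {X : Type*} [TopologicalSpace X] [ChartedSpace E3 X]

/-- A function is smooth if its coordinate expressions are. -/
def IsSmoothFun (σ : X → ℝ) : Prop :=
  ∀ x₀ : X, ContDiffOn ℝ ∞ (fun y => σ ((extChartAt (𝓡 3) x₀).symm y)) (extChartAt (𝓡 3) x₀).target

theorem isOpen_chart_target (i : X) : IsOpen (extChartAt (𝓡 3) i).target :=
  isOpen_extChartAt_target i

theorem chart_target_mem_nhds (x : X) :
    (extChartAt (𝓡 3) x).target ∈ nhds (extChartAt (𝓡 3) x x) :=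
  extChartAt_target_mem_nhds x

theorem IsSmoothForm.differentiableAt {k : ℕ} {η : DiffForm X k} (hη : IsSmoothForm η) {i : X}
    {y : E3} (hy : y ∈ (extChartAt (𝓡 3) i).target) : DifferentiableAt ℝ (formRep η i) y :=
  ((hη i).contDiffAt ((isOpen_chart_target i).mem_nhds hy)).differentiableAt (by simp)

theorem IsSmoothFun.differentiableAt {σ : X → ℝ} (hσ : IsSmoothFun σ) {i : X}
    {y : E3} (hy : y ∈ (extChartAt (𝓡 3) i).target) :
    DifferentiableAt ℝ (fun z => σ ((extChartAt (𝓡 3) i).symm z)) y :=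
  ((hσ i).contDiffAt ((isOpen_chart_target i).mem_nhds hy)).differentiableAt (by simp)

theorem formRep_add {k : ℕ} (η θ : DiffForm X k) (i : X) :
    formRep (η + θ) i = formRep η i + formRep θ i := by
  ext y v
  simp [formRep]

theorem formRep_smulForm {k : ℕ} (σ : X → ℝ) (η : DiffForm X k) (i : X) (y : E3) :
    formRep (smulForm σ η) i y = σ ((extChartAt (𝓡 3) i).symm y) • formRep η i y := by
  ext v
  simp [formRep, smulForm]

theorem formRep_wedge {k : ℕ} (α : DiffForm X 1) (η : DiffForm X k) (i : X) (y : E3) :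
    formRep (wedge α η) i y = wedgeOne (formRep α i y) (formRep η i y) :=
  wedgeOne_compContinuousLinearMap _ _ _

theorem IsSmoothForm.add {k : ℕ} {η θ : DiffForm X k} (hη : IsSmoothForm η)
    (hθ : IsSmoothForm θ) : IsSmoothForm (η + θ) := fun i => by
  rw [formRep_add]
  exact (hη i).add (hθ i)

theorem IsSmoothForm.smulForm {k : ℕ} {σ : X → ℝ} {η : DiffForm X k} (hσ : IsSmoothFun σ)
    (hη : IsSmoothForm η) : IsSmoothForm (smulForm σ η) := fun i => by
  rw [funext (formRep_smulForm σ η i)]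
  exact (hσ i).smul (hη i)

theorem IsSmoothForm.wedge {k : ℕ} {α : DiffForm X 1} {η : DiffForm X k} (hα : IsSmoothForm α)
    (hη : IsSmoothForm η) : IsSmoothForm (wedge α η) := fun i => by
  rw [funext (formRep_wedge α η i)]
  exact contDiffOn_wedgeOne (hα i) (hη i)

theorem IsSmoothFun.neg {σ : X → ℝ} (hσ : IsSmoothFun σ) : IsSmoothFun (-σ) := fun i => (hσ i).neg

theorem mfderiv_within_range {i : X} {y : E3} :
    mfderivWithin 𝓘(ℝ, E3) (𝓡 3) (extChartAt (𝓡 3) i).symm (Set.range (𝓡 3)) y =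
      chartSymmD i y := by
  rw [ModelWithCorners.range_eq_univ, mfderivWithin_univ]
  rfl

/-- The change of coordinates from the chart around `i` to the chart around `j`. -/
def transition (i j : X) (y : E3) : E3 := extChartAt (𝓡 3) j ((extChartAt (𝓡 3) i).symm y)

/-- The domain of the change of coordinates from the chart around `i` to the chart around `j`. -/
def overlap (i j : X) : Set E3 :=
  (extChartAt (𝓡 3) i).target ∩ (extChartAt (𝓡 3) i).symm ⁻¹' (extChartAt (𝓡 3) j).source

theorem isOpen_overlap (i j : X) : IsOpen (overlap i j) :=
  (continuousOn_extChartAt_symm i).isOpen_inter_preimage (isOpen_chart_target i)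
    (isOpen_extChartAt_source j)

theorem transition_mem_target {i j : X} {y : E3} (hy : y ∈ overlap i j) :
    transition i j y ∈ (extChartAt (𝓡 3) j).target :=
  (extChartAt (𝓡 3) j).map_source hy.2

theorem symm_transition {i j : X} {y : E3} (hy : y ∈ overlap i j) :
    (extChartAt (𝓡 3) j).symm (transition i j y) = (extChartAt (𝓡 3) i).symm y :=
  (extChartAt (𝓡 3) j).left_inv hy.2

variable [IsManifold (𝓡 3) ∞ X]

theorem isSmoothFun_of_contMDiff {σ : X → ℝ} (hσ : ContMDiff (𝓡 3) 𝓘(ℝ, ℝ) ∞ σ) :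
    IsSmoothFun σ := fun i => by
  have h := hσ.comp_contMDiffOn (contMDiffOn_extChartAt_symm (I := 𝓡 3) (n := ∞) i)
  exact contMDiffOn_iff_contDiffOn.1 h

instance isManifold_one : IsManifold (𝓡 3) 1 X := IsManifold.of_le (n := ∞) (by simp)

/-- The tangent space at `x` is identified with `E3` through the preferred chart at `x`, so in that
chart, and at that point only, coordinate expressions are the forms themselves. -/
theorem chartD_self (x : X) : chartD x x = ContinuousLinearMap.id ℝ E3 :=
  mfderiv_extChartAt_self

theorem chartSymmD_self (x : X) :
    chartSymmD x (extChartAt (𝓡 3) x x) = ContinuousLinearMap.id ℝ E3 := by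
  rw [← mfderiv_within_range]
  exact mfderivWithin_range_extChartAt_symm

theorem formRep_self {k : ℕ} (η : DiffForm X k) (x : X) :
    formRep η x (extChartAt (𝓡 3) x x) = η x := by
  rw [formRep, chartSymmD_self, extChartAt_to_inv]
  ext v
  rfl

theorem fieldRep_self (w : X → E3) (x : X) : fieldRep w x (extChartAt (𝓡 3) x x) = w x := by
  rw [fieldRep, extChartAt_to_inv, chartD_self]
  rfl

theorem extD_apply {k : ℕ} (η : DiffForm X k) (x : X) :
    extD η x = extDeriv (formRep η x) (extChartAt (𝓡 3) x x) := by
  rw [extD, chartD_self]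
  ext v
  rfl

theorem chartSymmD_comp_chartD {i : X} {y : E3} (hy : y ∈ (extChartAt (𝓡 3) i).target) :
    (chartSymmD i y).comp (chartD i ((extChartAt (𝓡 3) i).symm y)) =
      ContinuousLinearMap.id ℝ E3 := by
  have h := mfderivWithin_extChartAt_symm_comp_mfderiv_extChartAt (I := 𝓡 3) hy
  rw [mfderiv_within_range] at h
  exact h

theorem contDiffAt_transition {i j : X} {y : E3} (hy : y ∈ overlap i j) :
    ContDiffAt ℝ ∞ (transition i j) y := by
  have h := contDiffOn_ext_coord_change (I := 𝓡 3) (n := ∞) j i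
  refine h.contDiffAt ?_
  rw [PartialEquiv.trans_source, PartialEquiv.symm_source]
  exact (isOpen_overlap i j).mem_nhds hy

theorem fderiv_transition {i j : X} {y : E3} (hy : y ∈ overlap i j) :
    fderiv ℝ (transition i j) y =
      (chartD j ((extChartAt (𝓡 3) i).symm y)).comp (chartSymmD i y) := by
  have h1 : MDifferentiableAt 𝓘(ℝ, E3) (𝓡 3) (extChartAt (𝓡 3) i).symm y :=
    (mdifferentiableOn_extChartAt_symm y hy.1).mdifferentiableAt
      ((isOpen_chart_target i).mem_nhds hy.1)
  have h2 : MDifferentiableAt (𝓡 3) 𝓘(ℝ, E3) (extChartAt (𝓡 3) j)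
      ((extChartAt (𝓡 3) i).symm y) :=
    mdifferentiableAt_extChartAt (by rw [← extChartAt_source (I := 𝓡 3)]; exact hy.2)
  rw [← mfderiv_eq_fderiv]
  exact mfderiv_comp y h2 h1

/-- Coordinate expressions in two charts are related by pullback. -/
theorem formRep_transition {k : ℕ} (η : DiffForm X k) {i j : X} {y : E3} (hy : y ∈ overlap i j) :
    formRep η i y =
      (formRep η j (transition i j y)).compContinuousLinearMap (fderiv ℝ (transition i j) y) := by
  have h := chartSymmD_comp_chartD (transition_mem_target hy)
  rw [symm_transition hy] at h
  have h' : (chartSymmD j (transition i j y)).comp (fderiv ℝ (transition i j) y) =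
      chartSymmD i y := by
    rw [fderiv_transition hy, ← ContinuousLinearMap.comp_assoc, h, ContinuousLinearMap.id_comp]
  rw [formRep, formRep, symm_transition hy, ← h']
  ext v
  rfl

/-- The exterior derivative can be computed in every chart. -/
theorem formRep_extD {k : ℕ} {η : DiffForm X k} (hη : IsSmoothForm η) {i : X} {y : E3}
    (hy : y ∈ (extChartAt (𝓡 3) i).target) :
    formRep (extD η) i y = extDeriv (formRep η i) y := by
  -- `extD` at this point is computed in its own preferred chart, so the chart around `i` is
  -- compared with that one by naturality of `d` under the transition map.
  set x := (extChartAt (𝓡 3) i).symm y with hx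
  have hyo : y ∈ overlap i x := ⟨hy, mem_extChartAt_source x⟩
  have hev : formRep η i =ᶠ[nhds y] fun z =>
      (formRep η x (transition i x z)).compContinuousLinearMap (fderiv ℝ (transition i x) z) := by
    filter_upwards [(isOpen_overlap i x).mem_nhds hyo] with z hz using formRep_transition η hz
  -- Naturality of `d` needs symmetric second derivatives of the transition map, hence class `C²`.
  have hr : minSmoothness ℝ 2 ≤ (∞ : ℕ∞ω) := by
    rw [minSmoothness_of_isRCLikeNormedField]
    exact ENat.LEInfty.out
  rw [hev.extDeriv_eq, extDeriv_pullback (hη.differentiableAt (transition_mem_target hyo))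
    (contDiffAt_transition hyo) hr, fderiv_transition hyo, ← hx, chartD_self,
    ContinuousLinearMap.id_comp, formRep, ← hx, extD_apply]
  rfl

/-- The definition of `extD` changes chart from point to point; smoothness becomes visible only once
`formRep_extD` puts everything in one fixed chart. -/
theorem IsSmoothForm.extD {k : ℕ} {η : DiffForm X k} (hη : IsSmoothForm η) :
    IsSmoothForm (extD η) := fun i => by
  refine ContDiffOn.congr ?_ fun y hy => formRep_extD hη hy
  exact (ContinuousAlternatingMap.alternatizeUncurryFinCLM ℝ E3 ℝ).contDiff.comp_contDiffOn
    ((hη i).fderiv_of_isOpen (m := ∞) (isOpen_chart_target i) (by simp))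

end Charts

/-! ### Top forms and Stokes' theorem on the model space -/

section ModelSpace

open MeasureTheory

/-- The standard frame as a basis. -/
def stdBasis : Module.Basis (Fin 3) ℝ E3 := (EuclideanSpace.basisFun (Fin 3) ℝ).toBasis

theorem coe_stdBasis : ⇑stdBasis = stdFrame := by
  ext1 i
  simp [stdBasis, stdFrame]

theorem threeForm_comp_apply (η : E3 [⋀^Fin 3]→L[ℝ] ℝ) (L : E3 →L[ℝ] E3) :
    (η.compContinuousLinearMap L) stdFrame = L.det * η stdFrame := by
  have h : ∀ v, η v = η stdFrame * stdBasis.det v := fun v => by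
    have := congrArg (fun f => f v) (AlternatingMap.eq_smul_basis_det stdBasis η.toAlternatingMap)
    simpa [coe_stdBasis] using this
  rw [ContinuousAlternatingMap.compContinuousLinearMap_apply, h, ← coe_stdBasis]
  have := stdBasis.det_comp (L : E3 →ₗ[ℝ] E3) stdBasis
  rw [Module.Basis.det_self, mul_one] at this
  rw [mul_comm, ContinuousLinearMap.det, ← this]
  rfl

theorem threeForm_eq_zero {η : E3 [⋀^Fin 3]→L[ℝ] ℝ} (h : η stdFrame = 0) : η = 0 := by
  have := AlternatingMap.eq_smul_basis_det stdBasis η.toAlternatingMap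
  ext v
  have := congrArg (fun f => f v) this
  simpa [coe_stdBasis, h] using this

/-- Integration by parts against the constant function `1`. -/
theorem integral_fderiv_eq_zero {f : E3 → ℝ} (hf : ContDiff ℝ ∞ f) (hc : HasCompactSupport f)
    (v : E3) : ∫ y, fderiv ℝ f y v = 0 := by
  have hi : Integrable (fun y => fderiv ℝ f y v) :=
    ((hf.continuous_fderiv (by simp)).clm_apply continuous_const).integrable_of_hasCompactSupport
      (hc.fderiv_apply ℝ v)
  have := integral_mul_fderiv_eq_neg_fderiv_mul_of_integrable (μ := volume) (𝕜 := ℝ)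
    (f := fun _ : E3 => (1 : ℝ)) (g := f) (v := v) (by simp) (by simpa using hi)
    (by simpa using hf.continuous.integrable_of_hasCompactSupport hc)
    (fun _ _ => differentiableAt_const _) (fun _ _ => hf.differentiable (by simp) _)
  simpa using this

/-- **Stokes' theorem** for compactly supported forms on the model space. -/
theorem integral_extDeriv_eq_zero {W : E3 → E3 [⋀^Fin 2]→L[ℝ] ℝ} (hW : ContDiff ℝ ∞ W)
    (hc : HasCompactSupport W) : ∫ y, extDeriv W y stdFrame = 0 := by
  have hd : ∀ v : Fin 2 → E3, ContDiff ℝ ∞ (fun y => W y v) := fun v =>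
    (ContinuousAlternatingMap.apply ℝ E3 ℝ v).contDiff.comp hW
  have hcv : ∀ v : Fin 2 → E3, HasCompactSupport (fun y => W y v) := fun v =>
    hc.comp_left (g := fun η : E3 [⋀^Fin 2]→L[ℝ] ℝ => η v) rfl
  have hi : ∀ (v : Fin 2 → E3) (u : E3), Integrable (fun y => fderiv ℝ (fun z => W z v) y u) :=
    fun v u => (((hd v).continuous_fderiv (by simp)).clm_apply
      continuous_const).integrable_of_hasCompactSupport ((hcv v).fderiv_apply ℝ u)
  simp only [extDeriv_apply (hW.differentiable (by simp) _), zsmul_eq_mul]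
  rw [integral_finsetSum]
  · refine Finset.sum_eq_zero fun i _ => ?_
    rw [integral_const_mul, integral_fderiv_eq_zero (hd _) (hcv _), mul_zero]
  · intro i _
    exact (hi (i.removeNth stdFrame) (stdFrame i)).const_mul _

end ModelSpace

/-! ### Integration with a partition of unity and Stokes' theorem on the manifold -/

section Stokes

open MeasureTheory Filter

variable {X : Type*} [TopologicalSpace X] [ChartedSpace E3 X]

/-- The coordinate expression of `ζ` in the chart around `j`, with the sign that compares the
orientation of the chart with that given by `μ`, extended by zero. -/
def orientedRep {k : ℕ} (μ : DiffForm X 3) (j : X) (ζ : DiffForm X k) :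
    E3 → E3 [⋀^Fin k]→L[ℝ] ℝ :=
  (extChartAt (𝓡 3) j).target.indicator
    fun y => Real.sign (formRep μ j y stdFrame) • formRep ζ j y

/-- The integral of `ζ` over the domain of the chart around `j`. -/
def chartIntegral (μ : DiffForm X 3) (j : X) (ζ : DiffForm X 3) : ℝ :=
  ∫ y, orientedRep μ j ζ y stdFrame

/-- The form vanishes off a compact part of the domain of the chart around `j`. -/
def IsSupportedInChart {k : ℕ} (ζ : DiffForm X k) (j : X) : Prop :=
  ∃ K, IsCompact K ∧ K ⊆ (extChartAt (𝓡 3) j).source ∧ ∀ x ∉ K, ζ x = 0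

theorem formRep_eq_zero {k : ℕ} {ζ : DiffForm X k} {j : X} {y : E3}
    (h : ζ ((extChartAt (𝓡 3) j).symm y) = 0) : formRep ζ j y = 0 := by
  rw [formRep, h]
  rfl

theorem orientedRep_of_mem {k : ℕ} {μ : DiffForm X 3} {j : X} {ζ : DiffForm X k} {y : E3}
    (hy : y ∈ (extChartAt (𝓡 3) j).target) :
    orientedRep μ j ζ y = Real.sign (formRep μ j y stdFrame) • formRep ζ j y :=
  Set.indicator_of_mem hy _

theorem orientedRep_of_notMem {k : ℕ} {μ : DiffForm X 3} {j : X} {ζ : DiffForm X k} {y : E3}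
    (hy : y ∉ (extChartAt (𝓡 3) j).target) : orientedRep μ j ζ y = 0 :=
  Set.indicator_of_notMem hy _

theorem chartIntegral_eq_setIntegral (μ : DiffForm X 3) (j : X) (ζ : DiffForm X 3) :
    chartIntegral μ j ζ = ∫ y in (extChartAt (𝓡 3) j).target,
      Real.sign (formRep μ j y stdFrame) * formRep ζ j y stdFrame := by
  rw [chartIntegral, ← integral_indicator (isOpen_chart_target j).measurableSet]
  congr 1
  ext y
  by_cases hy : y ∈ (extChartAt (𝓡 3) j).target
  · rw [orientedRep_of_mem hy, Set.indicator_of_mem hy]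
    rfl
  · rw [orientedRep_of_notMem hy, Set.indicator_of_notMem hy]
    rfl

theorem orientedRep_eq_zero {k : ℕ} {μ : DiffForm X 3} {j : X} {ζ : DiffForm X k} {K : Set X}
    (hζ : ∀ x ∉ K, ζ x = 0) {y : E3}
    (hy : y ∉ extChartAt (𝓡 3) j '' K) : orientedRep μ j ζ y = 0 := by
  by_cases hyt : y ∈ (extChartAt (𝓡 3) j).target
  · have : (extChartAt (𝓡 3) j).symm y ∉ K := fun h =>
      hy ⟨_, h, (extChartAt (𝓡 3) j).right_inv hyt⟩
    rw [orientedRep_of_mem hyt, formRep_eq_zero (hζ _ this), smul_zero]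
  · exact Set.indicator_of_notMem hyt _

theorem isCompact_chart_image {j : X} {K : Set X} (hK : IsCompact K)
    (h : K ⊆ (extChartAt (𝓡 3) j).source) : IsCompact (extChartAt (𝓡 3) j '' K) :=
  hK.image_of_continuousOn ((continuousOn_extChartAt j).mono h)

theorem hasCompactSupport_orientedRep {k : ℕ} {μ : DiffForm X 3} {j : X} {ζ : DiffForm X k}
    (hs : IsSupportedInChart ζ j) : HasCompactSupport (orientedRep μ j ζ) := by
  obtain ⟨K, hK, hKj, hζ⟩ := hs
  exact HasCompactSupport.intro (isCompact_chart_image hK hKj) fun y hy =>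
    orientedRep_eq_zero hζ hy

/-- The support has compact, hence closed, image in the chart, so the extension by zero also
vanishes near boundary points of the target and stays smooth there. -/
theorem eventually_orientedRep_eq_zero {k : ℕ} {μ : DiffForm X 3} {j : X} {ζ : DiffForm X k}
    (hs : IsSupportedInChart ζ j) {y : E3} (hy : y ∉ (extChartAt (𝓡 3) j).target) :
    orientedRep μ j ζ =ᶠ[nhds y] fun _ => 0 := by
  obtain ⟨K, hK, hKj, hζ⟩ := hs
  have hy' : y ∉ extChartAt (𝓡 3) j '' K := by
    rintro ⟨x, hx, rfl⟩
    exact hy ((extChartAt (𝓡 3) j).map_source (hKj hx))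
  filter_upwards [(isCompact_chart_image hK hKj).isClosed.isOpen_compl.mem_nhds hy'] with z hz
  exact orientedRep_eq_zero hζ hz

theorem IsSmoothForm.finset_sum {k : ℕ} {ι : Type*} (s : Finset ι) {f : ι → DiffForm X k}
    (hf : ∀ i ∈ s, IsSmoothForm (f i)) : IsSmoothForm (∑ i ∈ s, f i) := by
  classical
  induction s using Finset.induction_on with
  | empty =>
    intro i
    have : formRep (0 : DiffForm X k) i = fun _ => 0 := by
      ext y v
      simp [formRep]
    rw [Finset.sum_empty, this]
    exact contDiffOn_const
  | insert a s ha ih =>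
    rw [Finset.sum_insert ha]
    exact (hf a (by simp)).add (ih fun i hi => hf i (by simp [hi]))

theorem IsSupportedInChart.smulForm {k : ℕ} {ζ : DiffForm X k} {j : X}
    (h : IsSupportedInChart ζ j) (σ : X → ℝ) : IsSupportedInChart (smulForm σ ζ) j := by
  obtain ⟨K, hK, hKj, hζ⟩ := h
  exact ⟨K, hK, hKj, fun x hx => by simp [ContactCS.smulForm, hζ x hx]⟩

variable [IsManifold (𝓡 3) ∞ X]

theorem formRep_stdFrame_ne_zero {μ : DiffForm X 3} (h : ∀ x, μ x ≠ 0) {j : X} {y : E3}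
    (hy : y ∈ (extChartAt (𝓡 3) j).target) : formRep μ j y stdFrame ≠ 0 := by
  intro h0
  refine h ((extChartAt (𝓡 3) j).symm y) ?_
  have h1 := threeForm_eq_zero h0
  -- Evaluating on vectors moved by `chartD` undoes the pullback by `chartSymmD`.
  ext v
  have h2 := congrArg (fun η : E3 [⋀^Fin 3]→L[ℝ] ℝ =>
    η (fun i => chartD j ((extChartAt (𝓡 3) j).symm y) (v i))) h1
  have h3 := fun u : E3 => congrArg (fun L : E3 →L[ℝ] E3 => L u) (chartSymmD_comp_chartD hy)
  simp only [ContinuousLinearMap.comp_apply, ContinuousLinearMap.id_apply] at h3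
  simp only [formRep, ContinuousAlternatingMap.compContinuousLinearMap_apply, Function.comp_def,
    h3] at h2
  exact h2

/-- A continuous function without zeros has locally constant sign; the orientation sign therefore
passes through `d` as a constant. -/
theorem eventually_sign_eq {μ : DiffForm X 3} (hμ : IsSmoothForm μ) (h : ∀ x, μ x ≠ 0) {j : X}
    {y : E3} (hy : y ∈ (extChartAt (𝓡 3) j).target) :
    ∀ᶠ z in nhds y, Real.sign (formRep μ j z stdFrame) = Real.sign (formRep μ j y stdFrame) := by
  have hc : ContinuousAt (fun z => formRep μ j z stdFrame) y :=
    (ContinuousAlternatingMap.apply ℝ E3 ℝ stdFrame).continuous.continuousAt.comp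
      (hμ.differentiableAt hy).continuousAt
  rcases lt_or_gt_of_ne (formRep_stdFrame_ne_zero h hy) with h0 | h0
  · filter_upwards [hc.eventually (gt_mem_nhds h0)] with z hz
    rw [Real.sign_of_neg hz, Real.sign_of_neg h0]
  · filter_upwards [hc.eventually (lt_mem_nhds h0)] with z hz
    rw [Real.sign_of_pos hz, Real.sign_of_pos h0]

theorem eventually_orientedRep_eq {k : ℕ} {μ : DiffForm X 3} (hμ : IsSmoothForm μ)
    (h : ∀ x, μ x ≠ 0) {j : X} (ζ : DiffForm X k) {y : E3}
    (hy : y ∈ (extChartAt (𝓡 3) j).target) :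
    orientedRep μ j ζ =ᶠ[nhds y] Real.sign (formRep μ j y stdFrame) • formRep ζ j := by
  filter_upwards [eventually_sign_eq hμ h hy, (isOpen_chart_target j).mem_nhds hy] with z hz hzt
  rw [orientedRep_of_mem hzt, hz]
  rfl

theorem contDiff_orientedRep {k : ℕ} {μ : DiffForm X 3} (hμ : IsSmoothForm μ)
    (h : ∀ x, μ x ≠ 0) {j : X} {ζ : DiffForm X k} (hζ : IsSmoothForm ζ)
    (hs : IsSupportedInChart ζ j) : ContDiff ℝ ∞ (orientedRep μ j ζ) := by
  rw [contDiff_iff_contDiffAt]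
  intro y
  by_cases hy : y ∈ (extChartAt (𝓡 3) j).target
  · exact (((hζ j).contDiffAt ((isOpen_chart_target j).mem_nhds hy)).const_smul
      (Real.sign (formRep μ j y stdFrame))).congr_of_eventuallyEq
      (eventually_orientedRep_eq hμ h ζ hy)
  · exact contDiffAt_const.congr_of_eventuallyEq (eventually_orientedRep_eq_zero hs hy)

theorem extDeriv_orientedRep {k : ℕ} {μ : DiffForm X 3} (hμ : IsSmoothForm μ)
    (h : ∀ x, μ x ≠ 0) {j : X} {ζ : DiffForm X k} (hζ : IsSmoothForm ζ)
    (hs : IsSupportedInChart ζ j) (y : E3) :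
    extDeriv (orientedRep μ j ζ) y = orientedRep μ j (extD ζ) y := by
  by_cases hy : y ∈ (extChartAt (𝓡 3) j).target
  · rw [(eventually_orientedRep_eq hμ h ζ hy).extDeriv_eq, extDeriv_smul,
      orientedRep_of_mem hy, formRep_extD hζ hy]
  · rw [(eventually_orientedRep_eq_zero hs hy).extDeriv_eq, orientedRep,
      Set.indicator_of_notMem hy, extDeriv]
    ext v
    simp [ContinuousAlternatingMap.alternatizeUncurryFin_apply]

theorem chartIntegral_extD {μ : DiffForm X 3} (hμ : IsSmoothForm μ)
    (h : ∀ x, μ x ≠ 0) {j : X} {ζ : DiffForm X 2} (hζ : IsSmoothForm ζ)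
    (hs : IsSupportedInChart ζ j) : chartIntegral μ j (extD ζ) = 0 := by
  rw [chartIntegral]
  simp only [← extDeriv_orientedRep hμ h hζ hs]
  exact integral_extDeriv_eq_zero (contDiff_orientedRep hμ h hζ hs)
    (hasCompactSupport_orientedRep hs)

theorem chartIntegral_sum {μ : DiffForm X 3} (hμ : IsSmoothForm μ)
    (h : ∀ x, μ x ≠ 0) {j : X} {ι : Type*} (s : Finset ι) {f : ι → DiffForm X 3}
    (hf : ∀ i ∈ s, IsSmoothForm (f i)) (hs : ∀ i ∈ s, IsSupportedInChart (f i) j) :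
    chartIntegral μ j (∑ i ∈ s, f i) = ∑ i ∈ s, chartIntegral μ j (f i) := by
  simp only [chartIntegral]
  rw [← integral_finsetSum]
  · congr 1
    ext y
    by_cases hy : y ∈ (extChartAt (𝓡 3) j).target
    · simp [orientedRep_of_mem hy, formRep, Finset.sum_apply, Finset.mul_sum]
    · simp [orientedRep_of_notMem hy]
  · intro i hi
    exact ((ContinuousAlternatingMap.apply ℝ E3 ℝ stdFrame).continuous.comp
      (contDiff_orientedRep hμ h (hf i hi) (hs i hi)).continuous).integrable_of_hasCompactSupport
      ((hasCompactSupport_orientedRep (hs i hi)).comp_left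
        (g := fun η : E3 [⋀^Fin 3]→L[ℝ] ℝ => η stdFrame) rfl)

/-- The integral of a form supported in two charts can be computed in either of them. -/
theorem chartIntegral_congr_chart (μ : DiffForm X 3) {i j : X} {ζ : DiffForm X 3}
    (hi : ∀ x ∉ (extChartAt (𝓡 3) i).source, ζ x = 0)
    (hj : ∀ x ∉ (extChartAt (𝓡 3) j).source, ζ x = 0) :
    chartIntegral μ i ζ = chartIntegral μ j ζ := by
  have hzero : ∀ {i j : X}, (∀ x ∉ (extChartAt (𝓡 3) j).source, ζ x = 0) →
      chartIntegral μ i ζ = ∫ y in overlap i j,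
        Real.sign (formRep μ i y stdFrame) * formRep ζ i y stdFrame := by
    intro i j hj
    rw [chartIntegral_eq_setIntegral]
    refine (setIntegral_eq_of_subset_of_forall_sdiff_eq_zero
      (isOpen_chart_target i).measurableSet Set.inter_subset_left fun y hy => ?_)
    have : (extChartAt (𝓡 3) i).symm y ∉ (extChartAt (𝓡 3) j).source := fun h => hy.2 ⟨hy.1, h⟩
    simp [formRep_eq_zero (hj _ this)]
  have himage : transition i j '' overlap i j = overlap j i := by
    ext z
    constructor
    · rintro ⟨y, hy, rfl⟩
      refine ⟨transition_mem_target hy, ?_⟩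
      rw [Set.mem_preimage, symm_transition hy]
      exact (extChartAt (𝓡 3) i).map_target hy.1
    · intro hz
      refine ⟨transition j i z, ⟨transition_mem_target hz, ?_⟩, ?_⟩
      · rw [Set.mem_preimage, symm_transition hz]
        exact (extChartAt (𝓡 3) j).map_target hz.1
      · rw [transition, symm_transition hz]
        exact (extChartAt (𝓡 3) j).right_inv hz.1
  have hinj : Set.InjOn (transition i j) (overlap i j) := by
    intro y hy z hz hyz
    have := congrArg (extChartAt (𝓡 3) j).symm hyz
    rw [symm_transition hy, symm_transition hz] at this
    exact (extChartAt (𝓡 3) i).symm.injOn hy.1 hz.1 this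
  rw [hzero hj, hzero hi, ← himage, integral_image_eq_integral_abs_det_fderiv_smul volume
    (isOpen_overlap i j).measurableSet (fun y hy =>
      ((contDiffAt_transition hy).differentiableAt (by simp)).hasFDerivAt.hasFDerivWithinAt) hinj]
  refine setIntegral_congr_fun (isOpen_overlap i j).measurableSet fun y hy => ?_
  simp only [formRep_transition _ hy, threeForm_comp_apply, smul_eq_mul]
  -- The two orientation signs differ by the sign of the Jacobian, which turns `det` into the
  -- `|det|` of the change of variables. If `det` or `μ` vanishes, both sides are zero.
  rcases lt_trichotomy (fderiv ℝ (transition i j) y).det 0 with hd | hd | hd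
  · rw [abs_of_neg hd]
    rcases lt_trichotomy (formRep μ j (transition i j y) stdFrame) 0 with hm | hm | hm
    · rw [Real.sign_of_pos (mul_pos_of_neg_of_neg hd hm), Real.sign_of_neg hm]
      ring
    · simp [hm]
    · rw [Real.sign_of_neg (mul_neg_of_neg_of_pos hd hm), Real.sign_of_pos hm]
      ring
  · simp [hd]
  · rw [abs_of_pos hd]
    rcases lt_trichotomy (formRep μ j (transition i j y) stdFrame) 0 with hm | hm | hm
    · rw [Real.sign_of_neg (mul_neg_of_pos_of_neg hd hm), Real.sign_of_neg hm]
      ring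
    · simp [hm]
    · rw [Real.sign_of_pos (mul_pos hd hm), Real.sign_of_pos hm]
      ring

theorem extD_add {k : ℕ} {η θ : DiffForm X k} (hη : IsSmoothForm η) (hθ : IsSmoothForm θ) :
    extD (η + θ) = extD η + extD θ := by
  funext x
  rw [Pi.add_apply, extD_apply, extD_apply, extD_apply, formRep_add,
    extDeriv_add (hη.differentiableAt (mem_extChartAt_target x))
      (hθ.differentiableAt (mem_extChartAt_target x))]

theorem extD_sum {k : ℕ} {ι : Type*} (s : Finset ι) {f : ι → DiffForm X k}
    (hf : ∀ i ∈ s, IsSmoothForm (f i)) : extD (∑ i ∈ s, f i) = ∑ i ∈ s, extD (f i) := by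
  classical
  induction s using Finset.induction_on with
  | empty =>
    funext x
    have : formRep (0 : DiffForm X k) x = fun _ => 0 := by
      ext y v
      simp [formRep]
    rw [Finset.sum_empty, Finset.sum_empty, extD_apply, this, extDeriv]
    ext v
    simp [ContinuousAlternatingMap.alternatizeUncurryFin_apply]
  | insert a s ha ih =>
    rw [Finset.sum_insert ha, Finset.sum_insert ha, extD_add (hf a (by simp))
      (IsSmoothForm.finset_sum s fun i hi => hf i (by simp [hi])),
      ih fun i hi => hf i (by simp [hi])]

theorem extD_eq_zero_of_notMem {k : ℕ} {η : DiffForm X k} {K : Set X} (hK : IsClosed K)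
    (hη : ∀ x ∉ K, η x = 0) {x : X} (hx : x ∉ K) : extD η x = 0 := by
  have hc : ContinuousAt (extChartAt (𝓡 3) x).symm (extChartAt (𝓡 3) x x) :=
    continuousAt_extChartAt_symm x
  have hev : formRep η x =ᶠ[nhds (extChartAt (𝓡 3) x x)] fun _ => 0 := by
    have : Kᶜ ∈ nhds ((extChartAt (𝓡 3) x).symm (extChartAt (𝓡 3) x x)) := by
      rw [extChartAt_to_inv]
      exact hK.isOpen_compl.mem_nhds hx
    filter_upwards [hc this] with z hz
    rw [formRep, hη _ hz]
    ext v
    simp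
  rw [extD_apply, hev.extDeriv_eq, extDeriv]
  ext v
  simp [ContinuousAlternatingMap.alternatizeUncurryFin_apply]

variable [CompactSpace X] [T2Space X]

theorem isSmoothFun_partUnity (i : X) : IsSmoothFun (partUnity X i) :=
  isSmoothFun_of_contMDiff (partUnity X i).contMDiff

variable (X) in
/-- The finitely many indices at which the partition of unity does not vanish. -/
def partIndex : Finset X :=
  (partUnity X).locallyFinite.finite_nonempty_of_compact.toFinset

theorem partUnity_eq_zero {i : X} (hi : i ∉ partIndex X) (x : X) : partUnity X i x = 0 := by
  by_contra h
  refine hi ?_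
  rw [partIndex, Set.Finite.mem_toFinset]
  exact ⟨x, h⟩

theorem sum_partUnity (x : X) : ∑ i ∈ partIndex X, partUnity X i x = 1 := by
  rw [← (partUnity X).sum_eq_one (Set.mem_univ x)]
  refine (finsum_eq_sum_of_support_subset _ fun i hi => ?_).symm
  by_contra h
  exact hi (partUnity_eq_zero h x)

theorem sum_smulForm_partUnity {k : ℕ} (η : DiffForm X k) :
    ∑ i ∈ partIndex X, smulForm (partUnity X i) η = η := by
  funext x
  simp only [Finset.sum_apply, smulForm]
  rw [← Finset.sum_smul, sum_partUnity, one_smul]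

theorem tsupport_partUnity_subset (i : X) :
    tsupport (partUnity X i) ⊆ (extChartAt (𝓡 3) i).source := by
  rw [extChartAt_source]
  exact partUnity_isSubordinate X i

theorem smulForm_partUnity_eq_zero {k : ℕ} (η : DiffForm X k) (i : X) {x : X}
    (hx : x ∉ tsupport (partUnity X i)) : smulForm (partUnity X i) η x = 0 := by
  rw [smulForm, image_eq_zero_of_notMem_tsupport hx, zero_smul]

theorem isSupportedInChart_partUnity {k : ℕ} (η : DiffForm X k) (i : X) :
    IsSupportedInChart (smulForm (partUnity X i) η) i :=
  ⟨_, (isClosed_tsupport _).isCompact, tsupport_partUnity_subset i,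
    fun _ hx => smulForm_partUnity_eq_zero η i hx⟩

/-- By compactness only finitely many functions of the partition are nonzero, so the `finsum` is an
honest finite sum. -/
theorem integral_eq_sum (μ η : DiffForm X 3) :
    integral μ η = ∑ i ∈ partIndex X, chartIntegral μ i (smulForm (partUnity X i) η) := by
  have h : ∀ i : X, (∫ y in (extChartAt (𝓡 3) i).target, Real.sign (formRep μ i y stdFrame) *
      (partUnity X i ((extChartAt (𝓡 3) i).symm y) * formRep η i y stdFrame)) =
      chartIntegral μ i (smulForm (partUnity X i) η) := fun i => by
    rw [chartIntegral_eq_setIntegral]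
    simp [formRep_smulForm]
  rw [integral, finsum_congr h]
  refine finsum_eq_sum_of_support_subset _ fun i hi => ?_
  by_contra h'
  refine hi ?_
  change chartIntegral μ i _ = 0
  rw [← h i]
  simp [partUnity_eq_zero h']

/-- Smoothness supplies the integrability that additivity of the integral requires: each cut-off
piece is continuous with compact support in its chart. -/
theorem integral_sum {μ : DiffForm X 3} (hμ : IsSmoothForm μ) (h : ∀ x, μ x ≠ 0) {ι : Type*}
    (s : Finset ι) {f : ι → DiffForm X 3} (hf : ∀ i ∈ s, IsSmoothForm (f i)) :
    integral μ (∑ i ∈ s, f i) = ∑ i ∈ s, integral μ (f i) := by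
  simp only [integral_eq_sum]
  rw [Finset.sum_comm]
  refine Finset.sum_congr rfl fun i _ => ?_
  rw [← chartIntegral_sum hμ h s (fun j hj => (hf j hj).smulForm (isSmoothFun_partUnity i))
    fun j _ => isSupportedInChart_partUnity (f j) i]
  congr 1
  funext x
  simp [smulForm, Finset.smul_sum]

theorem integral_add {μ : DiffForm X 3} (hμ : IsSmoothForm μ) (h : ∀ x, μ x ≠ 0)
    {η θ : DiffForm X 3} (hη : IsSmoothForm η) (hθ : IsSmoothForm θ) :
    integral μ (η + θ) = integral μ η + integral μ θ := by
  have := integral_sum hμ h (f := ![η, θ]) Finset.univ (by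
    intro i _
    fin_cases i
    exacts [hη, hθ])
  simpa using this

theorem integral_neg (μ η : DiffForm X 3) : integral μ (-η) = -integral μ η := by
  have h : ∀ i y, formRep (-η) i y stdFrame = -formRep η i y stdFrame := fun _ _ => rfl
  simp only [integral, h, mul_neg, MeasureTheory.integral_neg, finsum_neg_distrib]

/-- **Stokes' theorem** on a closed three-manifold. -/
theorem integral_extD {μ : DiffForm X 3} (hμ : IsSmoothForm μ) (h : ∀ x, μ x ≠ 0)
    {θ : DiffForm X 2} (hω : IsSmoothForm θ) : integral μ (extD θ) = 0 := by
  have hs : ∀ j, IsSmoothForm (smulForm (partUnity X j) θ) := fun j =>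
    hω.smulForm (isSmoothFun_partUnity j)
  have hz : ∀ j, ∀ x ∉ tsupport (partUnity X j), extD (smulForm (partUnity X j) θ) x = 0 :=
    fun j x hx => extD_eq_zero_of_notMem (isClosed_tsupport _)
      (fun _ h => smulForm_partUnity_eq_zero _ _ h) hx
  have hsupp : ∀ j, IsSupportedInChart (extD (smulForm (partUnity X j) θ)) j := fun j =>
    ⟨_, (isClosed_tsupport _).isCompact, tsupport_partUnity_subset j, hz j⟩
  -- The partition is used twice: once to cut `θ` into pieces supported in a chart `j`, and once,
  -- with index `i`, inside the integral.
  rw [← sum_smulForm_partUnity θ, extD_sum _ fun j _ => hs j,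
    integral_sum hμ h _ fun j _ => (hs j).extD]
  refine Finset.sum_eq_zero fun j _ => ?_
  rw [integral_eq_sum]
  -- Every term with index `i` is moved to the chart `j`; there the cut-offs sum to one, leaving the
  -- integral of an exact compactly supported form.
  have hcongr : ∀ i ∈ partIndex X,
      chartIntegral μ i (smulForm (partUnity X i) (extD (smulForm (partUnity X j) θ))) =
      chartIntegral μ j (smulForm (partUnity X i) (extD (smulForm (partUnity X j) θ))) := by
    intro i _
    refine chartIntegral_congr_chart μ (fun x hx => ?_) fun x hx => ?_
    · exact smulForm_partUnity_eq_zero _ _ fun h => hx (tsupport_partUnity_subset i h)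
    · rw [smulForm, hz j x fun h => hx (tsupport_partUnity_subset j h), smul_zero]
  rw [Finset.sum_congr rfl hcongr, ← chartIntegral_sum hμ h _
    (fun i _ => (hs j).extD.smulForm (isSmoothFun_partUnity i)) fun i _ => (hsupp j).smulForm _,
    sum_smulForm_partUnity]
  exact chartIntegral_extD hμ h (hs j) (isSupportedInChart_partUnity _ _)

end Stokes

/-! ### Alternating forms in a basis, the Hodge star, orthonormal frames -/

section LinearAlgebra

variable {V : Type*} [NormedAddCommGroup V] [NormedSpace ℝ V]

theorem curryLeft_apply₁ (β : V [⋀^Fin 2]→L[ℝ] ℝ) (u v : V) :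
    β.curryLeft u ![v] = β ![u, v] := rfl

theorem curryLeft_apply₂ (η : V [⋀^Fin 3]→L[ℝ] ℝ) (u v w : V) :
    η.curryLeft u ![v, w] = η ![u, v, w] := rfl

/-- A one-form as a linear functional. -/
def oneFormToLinear (α : V [⋀^Fin 1]→L[ℝ] ℝ) : V →ₗ[ℝ] ℝ where
  toFun v := α ![v]
  map_add' u v := by
    change α.curryLeft (u + v) ![] = α.curryLeft u ![] + α.curryLeft v ![]
    simp
  map_smul' c v := by
    change α.curryLeft (c • v) ![] = c * α.curryLeft v ![]
    simp

theorem oneForm_add (α : V [⋀^Fin 1]→L[ℝ] ℝ) (u v : V) : α ![u + v] = α ![u] + α ![v] :=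
  map_add (oneFormToLinear α) u v

theorem oneForm_sub (α : V [⋀^Fin 1]→L[ℝ] ℝ) (u v : V) : α ![u - v] = α ![u] - α ![v] :=
  map_sub (oneFormToLinear α) u v

theorem oneForm_neg (α : V [⋀^Fin 1]→L[ℝ] ℝ) (v : V) : α ![-v] = -α ![v] :=
  map_neg (oneFormToLinear α) v

theorem oneForm_smul (α : V [⋀^Fin 1]→L[ℝ] ℝ) (c : ℝ) (v : V) : α ![c • v] = c * α ![v] :=
  map_smul (oneFormToLinear α) c v

theorem twoForm_self (β : V [⋀^Fin 2]→L[ℝ] ℝ) (u : V) : β ![u, u] = 0 :=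
  β.map_eq_zero_of_eq _ (i := 0) (j := 1) rfl (by decide)

theorem twoForm_swap (β : V [⋀^Fin 2]→L[ℝ] ℝ) (u v : V) : β ![u, v] = -β ![v, u] := by
  have h := twoForm_self β (u + v)
  have h1 : ∀ a, β ![u + v, a] = β ![u, a] + β ![v, a] := fun a => by
    rw [← curryLeft_apply₁, map_add]
    rfl
  have h2 : ∀ a, β ![a, u + v] = β ![a, u] + β ![a, v] := fun a =>
    oneForm_add (β.curryLeft a) u v
  rw [h1, h2, h2, twoForm_self, twoForm_self] at h
  linarith

theorem twoForm_add_left (β : V [⋀^Fin 2]→L[ℝ] ℝ) (u v w : V) :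
    β ![u + v, w] = β ![u, w] + β ![v, w] := by
  rw [← curryLeft_apply₁, map_add]
  rfl

theorem twoForm_sub_left (β : V [⋀^Fin 2]→L[ℝ] ℝ) (u v w : V) :
    β ![u - v, w] = β ![u, w] - β ![v, w] := by
  rw [← curryLeft_apply₁, map_sub]
  rfl

theorem twoForm_smul_left (β : V [⋀^Fin 2]→L[ℝ] ℝ) (c : ℝ) (u w : V) :
    β ![c • u, w] = c * β ![u, w] := by
  rw [← curryLeft_apply₁, map_smul]
  rfl

theorem twoForm_add_right (β : V [⋀^Fin 2]→L[ℝ] ℝ) (u v w : V) :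
    β ![u, v + w] = β ![u, v] + β ![u, w] :=
  oneForm_add (β.curryLeft u) v w

theorem twoForm_sub_right (β : V [⋀^Fin 2]→L[ℝ] ℝ) (u v w : V) :
    β ![u, v - w] = β ![u, v] - β ![u, w] :=
  oneForm_sub (β.curryLeft u) v w

theorem twoForm_neg_right (β : V [⋀^Fin 2]→L[ℝ] ℝ) (u v : V) : β ![u, -v] = -β ![u, v] :=
  oneForm_neg (β.curryLeft u) v

theorem twoForm_smul_right (β : V [⋀^Fin 2]→L[ℝ] ℝ) (c : ℝ) (u v : V) :
    β ![u, c • v] = c * β ![u, v] :=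
  oneForm_smul (β.curryLeft u) c v

variable (e : Module.Basis (Fin 3) ℝ V)

theorem linear_expand (f : V →ₗ[ℝ] ℝ) (v : V) :
    f v = e.repr v 0 * f (e 0) + e.repr v 1 * f (e 1) + e.repr v 2 * f (e 2) := by
  conv_lhs => rw [← e.sum_repr v, Fin.sum_univ_three]
  simp only [map_add, map_smul, smul_eq_mul]

theorem oneForm_expand (α : V [⋀^Fin 1]→L[ℝ] ℝ) (v : V) :
    α ![v] = e.repr v 0 * α ![e 0] + e.repr v 1 * α ![e 1] + e.repr v 2 * α ![e 2] :=
  linear_expand e (oneFormToLinear α) v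

theorem twoForm_expand (β : V [⋀^Fin 2]→L[ℝ] ℝ) (u v : V) :
    β ![u, v] = β ![e 0, e 1] * (e.repr u 0 * e.repr v 1 - e.repr u 1 * e.repr v 0) +
      β ![e 0, e 2] * (e.repr u 0 * e.repr v 2 - e.repr u 2 * e.repr v 0) +
      β ![e 1, e 2] * (e.repr u 1 * e.repr v 2 - e.repr u 2 * e.repr v 1) := by
  have h1 : ∀ a, β ![a, v] = e.repr v 0 * β ![a, e 0] + e.repr v 1 * β ![a, e 1] +
      e.repr v 2 * β ![a, e 2] := fun a => oneForm_expand e (β.curryLeft a) v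
  have h2 : ∀ a, β ![u, a] = e.repr u 0 * β ![e 0, a] + e.repr u 1 * β ![e 1, a] +
      e.repr u 2 * β ![e 2, a] := fun a => by
    rw [twoForm_swap, ← curryLeft_apply₁, oneForm_expand e (β.curryLeft a) u, curryLeft_apply₁,
      curryLeft_apply₁, curryLeft_apply₁, twoForm_swap β a (e 0), twoForm_swap β a (e 1),
      twoForm_swap β a (e 2)]
    ring
  rw [h1, h2, h2, h2, twoForm_self, twoForm_self, twoForm_self, twoForm_swap β (e 1) (e 0),
    twoForm_swap β (e 2) (e 0), twoForm_swap β (e 2) (e 1)]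
  ring

theorem threeForm_expand (η : V [⋀^Fin 3]→L[ℝ] ℝ) (u v w : V) :
    η ![u, v, w] = η ![e 0, e 1, e 2] *
      (e.repr u 0 * (e.repr v 1 * e.repr w 2 - e.repr v 2 * e.repr w 1) -
        e.repr u 1 * (e.repr v 0 * e.repr w 2 - e.repr v 2 * e.repr w 0) +
        e.repr u 2 * (e.repr v 0 * e.repr w 1 - e.repr v 1 * e.repr w 0)) := by
  have h01 : ∀ a b, η ![a, a, b] = 0 := fun a b =>
    η.map_eq_zero_of_eq _ (i := 0) (j := 1) rfl (by decide)
  have h02 : ∀ a b, η ![a, b, a] = 0 := fun a b =>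
    η.map_eq_zero_of_eq _ (i := 0) (j := 2) rfl (by decide)
  have hadd : ∀ a b c d, η ![a + b, c, d] = η ![a, c, d] + η ![b, c, d] := fun a b c d => by
    rw [← curryLeft_apply₂, map_add]
    rfl
  have hsmul : ∀ (r : ℝ) (b c d : V), η ![r • b, c, d] = r * η ![b, c, d] := fun r b c d => by
    rw [← curryLeft_apply₂, map_smul]
    rfl
  have hadd' : ∀ a b c d, η ![a, b + c, d] = η ![a, b, d] + η ![a, c, d] := fun a b c d => by
    simp only [← curryLeft_apply₂, ← curryLeft_apply₁, map_add]
    rfl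
  have h12 : ∀ a b c, η ![a, b, c] = -η ![a, c, b] := fun a b c => by
    rw [← curryLeft_apply₂, twoForm_swap]
    rfl
  have h10 : ∀ a b c, η ![a, b, c] = -η ![b, a, c] := fun a b c => by
    have h := h01 (a + b) c
    rw [hadd, hadd', hadd', h01, h01] at h
    linarith
  have h2 : ∀ a, η ![a, v, w] =
      η ![a, e 0, e 1] * (e.repr v 0 * e.repr w 1 - e.repr v 1 * e.repr w 0) +
      η ![a, e 0, e 2] * (e.repr v 0 * e.repr w 2 - e.repr v 2 * e.repr w 0) +
      η ![a, e 1, e 2] * (e.repr v 1 * e.repr w 2 - e.repr v 2 * e.repr w 1) := fun a =>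
    twoForm_expand e (η.curryLeft a) v w
  have h1 : η ![u, v, w] = e.repr u 0 * η ![e 0, v, w] + e.repr u 1 * η ![e 1, v, w] +
      e.repr u 2 * η ![e 2, v, w] := by
    conv_lhs => rw [← e.sum_repr u, Fin.sum_univ_three]
    rw [hadd, hadd, hsmul, hsmul, hsmul]
  rw [h1, h2, h2, h2, h01, h01, h02, h01, h02, h02, h10 (e 1) (e 0) (e 2), h10 (e 2) (e 0) (e 1),
    h12 (e 0) (e 2) (e 1)]
  ring

/-- A three-form is a multiple of every nonzero three-form. -/
theorem threeForm_eq_smul {η μ : E3 [⋀^Fin 3]→L[ℝ] ℝ} (h : μ ≠ 0) :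
    η = (η stdFrame / μ stdFrame) • μ := by
  have hμ : μ stdFrame ≠ 0 := fun h0 => h (threeForm_eq_zero h0)
  refine sub_eq_zero.1 (threeForm_eq_zero ?_)
  simp [div_mul_cancel₀ _ hμ]

variable {e} {g : V → V → ℝ}

theorem hodgeStar_one (h : ∃ e : Module.Basis (Fin 3) ℝ V, IsOrthonormalFrame g e)
    (vol : V [⋀^Fin 3]→L[ℝ] ℝ) (β : V [⋀^Fin 1]→L[ℝ] ℝ) (v w : V) :
    hodgeStar g (k := 1) (m := 2) vol β ![v, w] = ∑ i, β ![h.choose i] * vol ![h.choose i, v, w] := by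
  rw [hodgeStar, dif_pos h, ← (Equiv.funUnique (Fin 1) (Fin 3)).symm.sum_comp]
  simp only [Nat.factorial_one, Nat.cast_one, inv_one, one_smul, ContinuousAlternatingMap.sum_apply,
    ContinuousAlternatingMap.smul_apply, smul_eq_mul]
  refine Finset.sum_congr rfl fun i _ => ?_
  have hi : (fun a => h.choose ((Equiv.funUnique (Fin 1) (Fin 3)).symm i a)) = ![h.choose i] := by
    ext1 a
    fin_cases a
    rfl
  rw [hi]
  rfl

theorem hodgeStar_two (h : ∃ e : Module.Basis (Fin 3) ℝ V, IsOrthonormalFrame g e)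
    (vol : V [⋀^Fin 3]→L[ℝ] ℝ) (β : V [⋀^Fin 2]→L[ℝ] ℝ) (v : V) :
    hodgeStar g (k := 2) (m := 1) vol β ![v] =
      2⁻¹ * ∑ i, ∑ j, β ![h.choose i, h.choose j] * vol ![h.choose i, h.choose j, v] := by
  rw [hodgeStar, dif_pos h, ← (finTwoArrowEquiv (Fin 3)).symm.sum_comp, Fintype.sum_prod_type]
  simp only [Nat.factorial_two, Nat.cast_ofNat, ContinuousAlternatingMap.sum_apply,
    ContinuousAlternatingMap.smul_apply, smul_eq_mul]
  congr 1
  refine Finset.sum_congr rfl fun i _ => Finset.sum_congr rfl fun j _ => ?_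
  have hij : (fun a => h.choose ((finTwoArrowEquiv (Fin 3)).symm (i, j) a)) =
      ![h.choose i, h.choose j] := by
    ext1 a
    fin_cases a <;> rfl
  rw [hij]
  rfl

/-- An orthogonal basis exists by symmetry, and positivity allows it to be normalized. This rules
out the junk branch of `hodgeStar`. -/
theorem exists_orthonormalFrame [FiniteDimensional ℝ V] (hV : Module.finrank ℝ V = 3)
    (B : LinearMap.BilinForm ℝ V) (hs : LinearMap.IsSymm B) (hp : ∀ v, v ≠ 0 → 0 < B v v) :
    ∃ e : Module.Basis (Fin 3) ℝ V, IsOrthonormalFrame (fun u v => B u v) e := by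
  obtain ⟨b, hb⟩ := LinearMap.BilinForm.exists_orthogonal_basis hs
  let b' := b.reindex (finCongr hV)
  have hpos : ∀ i, 0 < B (b' i) (b' i) := fun i => hp _ (b'.ne_zero i)
  have horth : ∀ i j, i ≠ j → B (b' i) (b' j) = 0 := fun i j hij => by
    have : (finCongr hV).symm i ≠ (finCongr hV).symm j := fun h => hij ((finCongr hV).symm.injective h)
    simpa [b'] using! hb this
  refine ⟨b'.isUnitSMul (w := fun i => (√(B (b' i) (b' i)))⁻¹) fun i =>
    (inv_ne_zero (Real.sqrt_pos.2 (hpos i)).ne').isUnit, fun i j => ?_⟩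
  simp only [Module.Basis.isUnitSMul_apply, map_smul, LinearMap.smul_apply, smul_eq_mul]
  split_ifs with hij
  · subst hij
    have h1 := Real.mul_self_sqrt (hpos i).le
    have h2 := (Real.sqrt_pos.2 (hpos i)).ne'
    field_simp
    rw [sq, h1]
  · rw [horth i j hij]
    simp

end LinearAlgebra

/-! ### Pointwise geometry of a contact metric structure -/

namespace ContactMetricStructure

variable {X : Type*} [TopologicalSpace X] [ChartedSpace E3 X] (M : ContactMetricStructure X)

/-- The metric at a point as a bilinear form. -/
def gForm (x : X) : LinearMap.BilinForm ℝ E3 :=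
  LinearMap.mk₂ ℝ (M.g x)
    (fun u v w => by
      rw [g, oneForm_add, twoForm_add_left, g, g]
      ring)
    (fun c u w => by
      rw [g, oneForm_smul, twoForm_smul_left, g, smul_eq_mul]
      ring)
    (fun u v w => by
      rw [g, oneForm_add, map_add, twoForm_add_right, g, g]
      ring)
    (fun c u w => by
      rw [g, oneForm_smul, map_smul, twoForm_smul_right, g, smul_eq_mul]
      ring)

theorem exists_frame (x : X) :
    ∃ e : Module.Basis (Fin 3) ℝ E3, IsOrthonormalFrame (M.g x) e :=
  exists_orthonormalFrame (by simp) (M.gForm x) ⟨fun u v => M.metric_symm x u v⟩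
    fun v hv => M.metric_pos x v hv

/-- The axiom covers horizontal vectors only; as `φ` kills `ξ`, it may be applied to the horizontal
part `v - κ(v)ξ`. -/
theorem κ_φ (x : X) (v : E3) : M.κ x ![M.φ x v] = 0 := by
  have h : M.κ x ![v - M.κ x ![v] • M.ξ x] = 0 := by
    rw [oneForm_sub, oneForm_smul, M.κ_ξ]
    ring
  have := M.φ_horizontal x _ h
  rwa [map_sub, map_smul, M.φ_ξ, smul_zero, sub_zero] at this

theorem φ_φ (x : X) (v : E3) : M.φ x (M.φ x v) = -v + M.κ x ![v] • M.ξ x := by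
  have h : M.κ x ![v - M.κ x ![v] • M.ξ x] = 0 := by
    rw [oneForm_sub, oneForm_smul, M.κ_ξ]
    ring
  have := M.φ_sq x _ h
  rw [map_sub, map_smul, M.φ_ξ, smul_zero, sub_zero] at this
  rw [this]
  abel

theorem vol_apply (x : X) (u v w : E3) : M.vol x ![u, v, w] =
    M.κ x ![u] * extD M.κ x ![v, w] - M.κ x ![v] * extD M.κ x ![u, w] +
      M.κ x ![w] * extD M.κ x ![u, v] :=
  wedgeOne_apply₃ _ _ _ _ _

section Frame

variable {M} {x : X} {e : Module.Basis (Fin 3) ℝ E3} (he : IsOrthonormalFrame (M.g x) e)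
include he

theorem repr_eq_g (i : Fin 3) (v : E3) : e.repr v i = M.g x (e i) v := by
  have h := linear_expand e (M.gForm x (e i)) v
  have h' : ∀ j, M.gForm x (e i) (e j) = if i = j then 1 else 0 := he i
  rw [h', h', h'] at h
  change _ = M.gForm x (e i) v
  rw [h]
  fin_cases i <;> simp

/-- `ξ` is metrically dual to `κ`: `φξ = 0` leaves `g(·, ξ) = κ`. -/
theorem repr_ξ (i : Fin 3) : e.repr (M.ξ x) i = M.κ x ![e i] := by
  have h0 : extD M.κ x ![e i, 0] = 0 := by
    have := twoForm_smul_right (extD M.κ x) 0 (e i) 0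
    simpa using this
  rw [repr_eq_g he, g, M.κ_ξ, M.φ_ξ, h0]
  ring

theorem sum_κ_sq : M.κ x ![e 0] ^ 2 + M.κ x ![e 1] ^ 2 + M.κ x ![e 2] ^ 2 = 1 := by
  have h := oneForm_expand e (M.κ x) (M.ξ x)
  rw [M.κ_ξ, repr_ξ he, repr_ξ he, repr_ξ he] at h
  linarith

/-- `g(u, φv) = dκ(u, φ²v) = -dκ(u, v)`, since `κ ∘ φ = 0` and `ι_ξ dκ = 0`. -/
theorem repr_φ (i j : Fin 3) : e.repr (M.φ x (e j)) i = -extD M.κ x ![e i, e j] := by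
  have h0 : extD M.κ x ![e i, M.ξ x] = 0 := by
    rw [twoForm_swap, M.dκ_ξ, neg_zero]
  rw [repr_eq_g he, g, M.κ_φ, M.φ_φ, twoForm_add_right, twoForm_smul_right, h0, twoForm_neg_right]
  ring

/-- The volume form of an orthonormal frame is `±1`. -/
theorem vol_frame_sq : M.vol x ![e 0, e 1, e 2] ^ 2 = 1 := by
  -- Orthonormality, with `φ` expressed through `dκ`, becomes the matrix equation `1 = κκᵀ + ωωᵀ`,
  -- where `ω` is the matrix of `dκ`.
  have h : ∀ i j, (if i = j then 1 else 0) = M.κ x ![e i] * M.κ x ![e j] +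
      (e.repr (M.φ x (e j)) 0 * extD M.κ x ![e i, e 0] +
        e.repr (M.φ x (e j)) 1 * extD M.κ x ![e i, e 1] +
        e.repr (M.φ x (e j)) 2 * extD M.κ x ![e i, e 2]) := fun i j => by
    rw [← he i j, g]
    congr 1
    exact oneForm_expand e ((extD M.κ x).curryLeft (e i)) (M.φ x (e j))
  simp only [repr_φ he] at h
  have h00 := h 0 0
  have h11 := h 1 1
  have h22 := h 2 2
  have h01 := h 0 1
  have h02 := h 0 2
  have h12 := h 1 2
  simp only [twoForm_self (extD M.κ x), twoForm_swap (extD M.κ x) (e 1) (e 0),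
    twoForm_swap (extD M.κ x) (e 2) (e 0), twoForm_swap (extD M.κ x) (e 2) (e 1)]
    at h00 h11 h22 h01 h02 h12
  have hk := sum_κ_sq he
  rw [vol_apply]
  generalize M.κ x ![e 0] = a at *
  generalize M.κ x ![e 1] = b at *
  generalize M.κ x ![e 2] = c at *
  generalize extD M.κ x ![e 0, e 1] = p at *
  generalize extD M.κ x ![e 0, e 2] = q at *
  generalize extD M.κ x ![e 1, e 2] = r at *
  norm_num [show (0 : Fin 3) ≠ 2 by decide, show (1 : Fin 3) ≠ 2 by decide]
    at h00 h11 h22 h01 h02 h12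
  -- The trace gives this norm. The relations below say that `(a, b, c)` and `(r, -q, p)` have the
  -- same products of entries, so they agree up to sign; the volume is their scalar product.
  have hs : p ^ 2 + q ^ 2 + r ^ 2 = 1 := by linarith
  have ha : a ^ 2 = r ^ 2 := by linarith
  have hb : b ^ 2 = q ^ 2 := by linarith
  have hc : c ^ 2 = p ^ 2 := by linarith
  have hab : a * b = -(q * r) := by linarith
  have hac : a * c = p * r := by linarith
  have hbc : b * c = -(p * q) := by linarith
  linear_combination r ^ 2 * ha + q ^ 2 * hb + p ^ 2 * hc - 2 * r * q * hab + 2 * r * p * hac -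
    2 * p * q * hbc + (p ^ 2 + q ^ 2 + r ^ 2 + 1) * hs

end Frame

/-- The values of the Hodge stars in coordinates with respect to an orthonormal frame. -/
theorem exists_frame_star (x : X) : ∃ e : Module.Basis (Fin 3) ℝ E3, IsOrthonormalFrame (M.g x) e ∧
    (∀ (β : DiffForm X 1) (v w : E3), M.star₁ β x ![v, w] = M.vol x ![e 0, e 1, e 2] *
      (β x ![e 0] * (e.repr v 1 * e.repr w 2 - e.repr v 2 * e.repr w 1) -
        β x ![e 1] * (e.repr v 0 * e.repr w 2 - e.repr v 2 * e.repr w 0) +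
        β x ![e 2] * (e.repr v 0 * e.repr w 1 - e.repr v 1 * e.repr w 0))) ∧
    ∀ (β : DiffForm X 2) (v : E3), M.star₂ β x ![v] = M.vol x ![e 0, e 1, e 2] *
      (β x ![e 1, e 2] * e.repr v 0 - β x ![e 0, e 2] * e.repr v 1 +
        β x ![e 0, e 1] * e.repr v 2) := by
  -- This is the very frame chosen inside `hodgeStar`, so independence of the frame is never needed.
  refine ⟨(M.exists_frame x).choose, (M.exists_frame x).choose_spec, fun β v w => ?_,
    fun β v => ?_⟩
  · rw [star₁, hodgeStar_one (M.exists_frame x)]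
    generalize (M.exists_frame x).choose = e
    simp only [threeForm_expand e (M.vol x) _ v w, Fin.sum_univ_three]
    simp
    ring
  · rw [star₂, hodgeStar_two (M.exists_frame x)]
    generalize (M.exists_frame x).choose = e
    simp only [threeForm_expand e (M.vol x) _ _ v, Fin.sum_univ_three, twoForm_self,
      twoForm_swap (β x) (e 1) (e 0), twoForm_swap (β x) (e 2) (e 0),
      twoForm_swap (β x) (e 2) (e 1)]
    simp
    ring

/-- In an orthonormal frame the two stars multiply every component by the square of the frame's
volume, which is `1` whatever its orientation. -/
theorem star₁_star₂ (β : DiffForm X 2) : M.star₁ (M.star₂ β) = β := by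
  funext x
  obtain ⟨e, he, h1, h2⟩ := M.exists_frame_star x
  refine ext₂ fun u v => ?_
  rw [h1, h2, h2, h2, twoForm_expand e (β x) u v]
  have hV := vol_frame_sq he
  simp only [Module.Basis.repr_self, Finsupp.single_apply]
  norm_num [show (0 : Fin 3) ≠ 2 by decide, show (1 : Fin 3) ≠ 2 by decide,
    show (2 : Fin 3) ≠ 0 by decide, show (2 : Fin 3) ≠ 1 by decide]
  linear_combination (β x ![e 0, e 1] * (e.repr u 0 * e.repr v 1 - e.repr u 1 * e.repr v 0) +
      β x ![e 0, e 2] * (e.repr u 0 * e.repr v 2 - e.repr u 2 * e.repr v 0) +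
      β x ![e 1, e 2] * (e.repr u 1 * e.repr v 2 - e.repr u 2 * e.repr v 1)) * hV

theorem starH₁_apply (β : DiffForm X 1) (x : X) (v : E3) :
    M.starH₁ β x ![v] = M.star₁ β x ![M.ξ x, v] := rfl

/-- The horizontal star squares to `-1` on horizontal one-forms. -/
theorem starH₁_neg_starH₁ {B : DiffForm X 1} (hB : M.IsHorizontal B) :
    M.starH₁ (-M.starH₁ B) = B := by
  funext x
  obtain ⟨e, he, h1, -⟩ := M.exists_frame_star x
  refine ext₁ fun v => ?_
  have hn : ∀ w, (-M.starH₁ B) x ![w] = -M.star₁ B x ![M.ξ x, w] := fun _ => rfl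
  have hξ := oneForm_expand e (B x) (M.ξ x)
  rw [hB x] at hξ
  rw [starH₁_apply, h1, hn, hn, hn, h1, h1, h1, oneForm_expand e (B x) v]
  have hV := vol_frame_sq he
  have hk := sum_κ_sq he
  simp only [repr_ξ he] at hξ ⊢
  simp only [Module.Basis.repr_self, Finsupp.single_apply]
  norm_num [show (0 : Fin 3) ≠ 2 by decide, show (1 : Fin 3) ≠ 2 by decide,
    show (2 : Fin 3) ≠ 0 by decide, show (2 : Fin 3) ≠ 1 by decide]
  generalize M.vol x ![e 0, e 1, e 2] = V at *
  generalize M.κ x ![e 0] = a at *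
  generalize M.κ x ![e 1] = b at *
  generalize M.κ x ![e 2] = c at *
  generalize B x ![e 0] = p at *
  generalize B x ![e 1] = q at *
  generalize B x ![e 2] = r at *
  generalize e.repr v 0 = v0 at *
  generalize e.repr v 1 = v1 at *
  generalize e.repr v 2 = v2 at *
  -- The double cross product `ξ × (ξ × B) = (ξ·B)ξ - |ξ|²B` in components: `hk` says `|ξ| = 1`,
  -- `hξ` says `ξ·B = 0`, and `hV` removes the volume factors.
  linear_combination (p * v0 + q * v1 + r * v2) * (hV + V ^ 2 * hk) +
    V ^ 2 * (a * v0 + b * v1 + c * v2) * hξ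

theorem vol_ne_zero (x : X) : M.vol x ≠ 0 := M.contact x

theorem vol_stdFrame_ne_zero (x : X) : M.vol x stdFrame ≠ 0 := fun h =>
  M.vol_ne_zero x (threeForm_eq_zero h)

/-- `η = (η / vol) vol` for every three-form `η`. -/
theorem eq_quot_smul_vol (η : DiffForm X 3) (x : X) : η x = quot η M.vol x • M.vol x :=
  threeForm_eq_smul (M.vol_ne_zero x)

/-- `ι_ξ ⋆ β` is the quotient of `κ ∧ β` by the volume form. -/
theorem starH₂_apply (β : DiffForm X 2) (x : X) (v : Fin 0 → E3) :
    M.starH₂ β x v = quot (wedge M.κ β) M.vol x := by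
  obtain ⟨e, he, -, h2⟩ := M.exists_frame_star x
  have hV := vol_frame_sq he
  have h : M.starH₂ β x v = M.star₂ β x ![M.ξ x] := by
    rw [Subsingleton.elim v ![]]
    rfl
  have hq := congrArg (fun η : E3 [⋀^Fin 3]→L[ℝ] ℝ => η ![e 0, e 1, e 2])
    (M.eq_quot_smul_vol (wedge M.κ β) x)
  simp only [ContinuousAlternatingMap.smul_apply, smul_eq_mul, wedge, wedgeOne_apply₃] at hq
  rw [h, h2, repr_ξ he, repr_ξ he, repr_ξ he]
  generalize quot (wedge M.κ β) M.vol x = t at *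
  linear_combination M.vol x ![e 0, e 1, e 2] * hq + t * hV

end ContactMetricStructure

/-! ### Product rules on a normed space -/

section Evaluation

variable {V : Type*} [NormedAddCommGroup V] [NormedSpace ℝ V]

theorem compContinuousLinearMap_apply₁ (α : V [⋀^Fin 1]→L[ℝ] ℝ) (L : V →L[ℝ] V) (v : V) :
    α.compContinuousLinearMap L ![v] = α ![L v] := by
  rw [ContinuousAlternatingMap.compContinuousLinearMap_apply]
  congr 1
  ext1 i
  fin_cases i
  rfl

theorem compContinuousLinearMap_apply₂ (β : V [⋀^Fin 2]→L[ℝ] ℝ) (L : V →L[ℝ] V) (u v : V) :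
    β.compContinuousLinearMap L ![u, v] = β ![L u, L v] := by
  rw [ContinuousAlternatingMap.compContinuousLinearMap_apply]
  congr 1
  ext1 i
  fin_cases i <;> rfl

/-- One-forms as continuous linear functionals. -/
def oneFormEquiv : (V [⋀^Fin 1]→L[ℝ] ℝ) ≃ₗᵢ[ℝ] (V →L[ℝ] ℝ) :=
  (ContinuousAlternatingMap.ofSubsingletonLIE (0 : Fin 1)).symm

theorem oneFormEquiv_apply (α : V [⋀^Fin 1]→L[ℝ] ℝ) (v : V) : oneFormEquiv α v = α ![v] :=
  ofSubsingleton_symm_apply α v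

theorem fderiv_oneForm_apply {a : V → V [⋀^Fin 1]→L[ℝ] ℝ} {w : V → V} {x : V}
    (ha : DifferentiableAt ℝ a x) (hw : DifferentiableAt ℝ w x) (u : V) :
    fderiv ℝ (fun y => a y ![w y]) x u = fderiv ℝ a x u ![w x] + a x ![fderiv ℝ w x u] := by
  have h1 : HasFDerivAt (fun y => oneFormEquiv (a y))
      ((oneFormEquiv (V := V)).toContinuousLinearEquiv.toContinuousLinearMap.comp (fderiv ℝ a x))
      x :=
    (oneFormEquiv (V := V)).toContinuousLinearEquiv.hasFDerivAt.comp x ha.hasFDerivAt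
  have h2 := (h1.clm_apply hw.hasFDerivAt).fderiv
  simp only [oneFormEquiv_apply] at h2
  rw [h2, ← oneFormEquiv_apply, ← oneFormEquiv_apply, add_comm]
  rfl

theorem fderiv_wedgeOne_apply {a b : V → V [⋀^Fin 1]→L[ℝ] ℝ} {x : V}
    (ha : DifferentiableAt ℝ a x) (hb : DifferentiableAt ℝ b x)
    (hab : DifferentiableAt ℝ (fun y => wedgeOne (a y) (b y)) x) (u v w : V) :
    fderiv ℝ (fun y => wedgeOne (a y) (b y)) x u ![v, w] =
      fderiv ℝ a x u ![v] * b x ![w] + a x ![v] * fderiv ℝ b x u ![w] -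
        (fderiv ℝ a x u ![w] * b x ![v] + a x ![w] * fderiv ℝ b x u ![v]) := by
  have h : ∀ {c : V → V [⋀^Fin 1]→L[ℝ] ℝ} (_ : DifferentiableAt ℝ c x) (v : V),
      DifferentiableAt ℝ (fun y => c y ![v]) x := fun hc v =>
    (ContinuousAlternatingMap.apply ℝ V ℝ ![v]).differentiableAt.comp x hc
  rw [← fderiv_continuousAlternatingMap_apply_const_apply hab]
  simp only [wedgeOne_apply₂]
  rw [fderiv_fun_sub ((h ha v).fun_mul (h hb w)) ((h ha w).fun_mul (h hb v)),
    fderiv_fun_mul (h ha v) (h hb w), fderiv_fun_mul (h ha w) (h hb v)]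
  simp only [_root_.sub_apply, _root_.add_apply,
    _root_.smul_apply, smul_eq_mul,
    fderiv_continuousAlternatingMap_apply_const_apply ha,
    fderiv_continuousAlternatingMap_apply_const_apply hb]
  ring

end Evaluation

/-! ### Leibniz rules and Cartan's formula on the manifold -/

section Leibniz

variable {X : Type*} [TopologicalSpace X] [ChartedSpace E3 X]

/-- The differential of a function. -/
def funD (σ : X → ℝ) (x : X) : E3 →L[ℝ] ℝ :=
  fderiv ℝ (fun y => σ ((extChartAt (𝓡 3) x).symm y)) (extChartAt (𝓡 3) x x)

theorem funD_neg (σ : X → ℝ) (x : X) (v : E3) : funD (-σ) x v = -funD σ x v := by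
  have : funD (-σ) x = -funD σ x := fderiv_neg
  rw [this]
  rfl

/-- `quot` evaluates on the frame of the preferred chart at each point, and this frame need not vary
continuously. The ratio of two top forms does not depend on the frame, so it equals the ratio of
coordinate expressions in one fixed chart. -/
theorem isSmoothFun_quot {η μ : DiffForm X 3} (hη : IsSmoothForm η) (hμ : IsSmoothForm μ)
    (h0 : ∀ i : X, ∀ y ∈ (extChartAt (𝓡 3) i).target, formRep μ i y stdFrame ≠ 0)
    (h : ∀ x, μ x ≠ 0) : IsSmoothFun (quot η μ) := fun i => by
  have hstd : ∀ {θ : DiffForm X 3}, IsSmoothForm θ →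
      ContDiffOn ℝ ∞ (fun y => formRep θ i y stdFrame) (extChartAt (𝓡 3) i).target := fun hθ =>
    (ContinuousAlternatingMap.apply ℝ E3 ℝ stdFrame).contDiff.comp_contDiffOn (hθ i)
  refine ((hstd hη).div (hstd hμ) (h0 i)).congr fun y hy => ?_
  rw [Pi.div_apply, eq_div_iff (h0 i y hy)]
  have hq : η = smulForm (quot η μ) μ := funext fun x => threeForm_eq_smul (h x)
  conv_rhs => rw [hq, formRep_smulForm]
  rfl

variable [IsManifold (𝓡 3) ∞ X]

theorem formRep_apply_fieldRep (α : DiffForm X 1) (w : X → E3) {i : X} {y : E3}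
    (hy : y ∈ (extChartAt (𝓡 3) i).target) :
    formRep α i y ![fieldRep w i y] =
      α ((extChartAt (𝓡 3) i).symm y) ![w ((extChartAt (𝓡 3) i).symm y)] := by
  have h := congrArg (fun L : E3 →L[ℝ] E3 => L (w ((extChartAt (𝓡 3) i).symm y)))
    (chartSymmD_comp_chartD hy)
  simp only [ContinuousLinearMap.comp_apply, ContinuousLinearMap.id_apply] at h
  rw [formRep, compContinuousLinearMap_apply₁, fieldRep, h]

theorem isSmoothFun_apply {α : DiffForm X 1} {w : X → E3} (hα : IsSmoothForm α)
    (hw : IsSmoothField w) : IsSmoothFun (fun x => α x ![w x]) := fun i => by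
  refine ContDiffOn.congr ?_ fun y hy => (formRep_apply_fieldRep α w hy).symm
  have := ((oneFormEquiv (V := E3)).contDiff.comp_contDiffOn (hα i)).clm_apply (hw i)
  refine this.congr fun y _ => ?_
  exact (oneFormEquiv_apply _ _).symm

theorem extD_ofFun {η : DiffForm X 0} {σ : X → ℝ} (h : ∀ x v, η x v = σ x) (x : X) (v : E3) :
    extD η x ![v] = funD σ x v := by
  have hr : formRep η x = fun y => ContinuousAlternatingMap.constOfIsEmpty ℝ E3 (Fin 0)
      (σ ((extChartAt (𝓡 3) x).symm y)) := by
    ext y v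
    exact h _ _
  rw [extD_apply, hr, extDeriv_constOfIsEmpty]
  rfl

theorem extD_apply₂ {A : DiffForm X 1} (hA : IsSmoothForm A) (x : X) (u v : E3) :
    extD A x ![u, v] = fderiv ℝ (formRep A x) (extChartAt (𝓡 3) x x) u ![v] -
      fderiv ℝ (formRep A x) (extChartAt (𝓡 3) x x) v ![u] := by
  rw [extD_apply, extDeriv_apply₂ (hA.differentiableAt (mem_extChartAt_target x))]

/-- `d(σA) = dσ ∧ A + σ dA`. -/
theorem extD_smulForm_apply {σ : X → ℝ} (hσ : IsSmoothFun σ) {A : DiffForm X 1}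
    (hA : IsSmoothForm A) (x : X) (u v : E3) :
    extD (smulForm σ A) x ![u, v] =
      σ x * extD A x ![u, v] + funD σ x u * A x ![v] - funD σ x v * A x ![u] := by
  have h := fderiv_fun_smul (hσ.differentiableAt (mem_extChartAt_target x))
    (hA.differentiableAt (mem_extChartAt_target x))
  have hd : ∀ a b, fderiv ℝ (formRep (smulForm σ A) x) (extChartAt (𝓡 3) x x) a ![b] =
      σ x * fderiv ℝ (formRep A x) (extChartAt (𝓡 3) x x) a ![b] + funD σ x a * A x ![b] := by
    intro a b
    rw [funext (formRep_smulForm σ A x), h, formRep_self, extChartAt_to_inv]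
    rfl
  rw [extD_apply₂ (hA.smulForm hσ), extD_apply₂ hA, hd, hd]
  ring

/-- `d(A ∧ B) = dA ∧ B - A ∧ dB`. -/
theorem extD_wedge_apply {A B : DiffForm X 1} (hA : IsSmoothForm A) (hB : IsSmoothForm B) (x : X)
    (u v w : E3) :
    extD (wedge A B) x ![u, v, w] =
      B x ![u] * extD A x ![v, w] - B x ![v] * extD A x ![u, w] + B x ![w] * extD A x ![u, v] -
        (A x ![u] * extD B x ![v, w] - A x ![v] * extD B x ![u, w] +
          A x ![w] * extD B x ![u, v]) := by
  have hw := (hA.wedge hB).differentiableAt (mem_extChartAt_target x)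
  rw [extD_apply, extDeriv_apply₃ hw, funext (formRep_wedge A B x)]
  rw [funext (formRep_wedge A B x)] at hw
  simp only [fderiv_wedgeOne_apply (hA.differentiableAt (mem_extChartAt_target x))
    (hB.differentiableAt (mem_extChartAt_target x)) hw, formRep_self]
  rw [extD_apply₂ hA, extD_apply₂ hA, extD_apply₂ hA, extD_apply₂ hB, extD_apply₂ hB,
    extD_apply₂ hB]
  ring

/-- Cartan's formula `L_w A = ι_w dA` for a one-form annihilated by `w`. -/
theorem lieD_apply {w : X → E3} (hw : IsSmoothField w) {A : DiffForm X 1} (hA : IsSmoothForm A)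
    (h : ∀ x, A x ![w x] = 0) (x : X) (v : E3) : lieD w A x ![v] = extD A x ![w x, v] := by
  have hwd : DifferentiableAt ℝ (fieldRep w x) (extChartAt (𝓡 3) x x) :=
    ((hw x).contDiffAt (chart_target_mem_nhds x)).differentiableAt (by simp)
  -- Differentiating `A(w) = 0` trades the derivative of `w` in the Lie derivative for minus a
  -- derivative of `A`, which completes `ι_w dA`.
  have hev : (fun y => formRep A x y ![fieldRep w x y]) =ᶠ[nhds (extChartAt (𝓡 3) x x)]
      fun _ => (0 : ℝ) := by
    filter_upwards [chart_target_mem_nhds x] with y hy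
    rw [formRep_apply_fieldRep A w hy, h]
  have hd := fderiv_oneForm_apply (hA.differentiableAt (mem_extChartAt_target x)) hwd v
  rw [hev.fderiv_eq, fderiv_fun_const, fieldRep_self, formRep_self] at hd
  change (0 : ℝ) = _ at hd
  have hl : lieD w A x ![v] =
      fderiv ℝ (formRep A x) (extChartAt (𝓡 3) x x) (w x) ![v] +
        A x ![fderiv ℝ (fieldRep w x) (extChartAt (𝓡 3) x x) v] := by
    rw [lieD, chartD_self, compContinuousLinearMap_apply₁, fieldRep_self, formRep_self,
      ← compContinuousLinearMap_apply₁ (A x)]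
    rfl
  rw [hl, extD_apply₂ hA]
  linarith

end Leibniz

section Integral

variable {X : Type*} [TopologicalSpace X] [ChartedSpace E3 X] [IsManifold (𝓡 3) ∞ X]
  [CompactSpace X] [T2Space X]

theorem integral_zero (μ : DiffForm X 3) : integral μ 0 = 0 := by
  have := integral_neg μ 0
  rw [neg_zero] at this
  linarith

end Integral

/-! ### Rumin's lift, the contact operator and the action -/

namespace ContactMetricStructure

variable {X : Type*} [TopologicalSpace X] [ChartedSpace E3 X] (M : ContactMetricStructure X)

/-- The function `f` with `κ ∧ dA = f (κ ∧ dκ)`. -/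
def verticalCurvature (A : DiffForm X 1) : X → ℝ := quot (wedge M.κ (extD A)) M.vol

theorem κ_wedge_extD (A : DiffForm X 1) :
    wedge M.κ (extD A) = smulForm (M.verticalCurvature A) M.vol :=
  funext fun x => M.eq_quot_smul_vol _ x

theorem κ_wedge_extD_apply (A : DiffForm X 1) (x : X) (u v w : E3) :
    M.κ x ![u] * extD A x ![v, w] - M.κ x ![v] * extD A x ![u, w] +
      M.κ x ![w] * extD A x ![u, v] = M.verticalCurvature A x *
    (M.κ x ![u] * extD M.κ x ![v, w] - M.κ x ![v] * extD M.κ x ![u, w] +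
      M.κ x ![w] * extD M.κ x ![u, v]) := by
  have h := congrArg (fun η : E3 [⋀^Fin 3]→L[ℝ] ℝ => η ![u, v, w])
    (congrFun (M.κ_wedge_extD A) x)
  simp only [wedge, wedgeOne_apply₃] at h
  rw [h, ← vol_apply]
  rfl

theorem projH_apply (x : X) (v : E3) : M.projH x v = v - M.κ x ![v] • M.ξ x := by
  rw [← ofSubsingleton_symm_apply]
  rfl

/-- The part removed by the projection is `κ ∧ ι_ξ dA`, which `κ` annihilates. Hence `⋆_H d_H A` is
the function `f`. -/
theorem κ_wedge_dH (A : DiffForm X 1) : wedge M.κ (M.dH A) = wedge M.κ (extD A) := by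
  funext x
  refine ext₃ fun u v w => ?_
  have h : ∀ a b, M.dH A x ![a, b] = extD A x ![a, b] - M.κ x ![b] * extD A x ![a, M.ξ x] -
      M.κ x ![a] * extD A x ![M.ξ x, b] := fun a b => by
    rw [dH, compContinuousLinearMap_apply₂, projH_apply, projH_apply, twoForm_sub_left,
      twoForm_sub_right, twoForm_sub_right, twoForm_smul_left, twoForm_smul_left,
      twoForm_smul_right, twoForm_smul_right, twoForm_self]
    ring
  simp only [wedge, wedgeOne_apply₃, h]
  rw [twoForm_swap (extD A x) u (M.ξ x), twoForm_swap (extD A x) v (M.ξ x)]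
  ring

/-- The horizontal lift of the vertical part: the candidate for Rumin's lift `l(A)`. -/
def ruminLift (A : DiffForm X 1) : DiffForm X 1 := A + smulForm (-M.verticalCurvature A) M.κ

theorem isSmoothForm_add_smul_κ {A : DiffForm X 1} (hA : IsSmoothForm A) {σ : X → ℝ}
    (hσ : IsSmoothFun σ) : IsSmoothForm (A + smulForm σ M.κ) :=
  hA.add (M.smooth_κ.smulForm hσ)

variable [IsManifold (𝓡 3) ∞ X]

theorem isSmoothForm_vol : IsSmoothForm M.vol := M.smooth_κ.wedge M.smooth_κ.extD

theorem isSmoothFun_verticalCurvature {A : DiffForm X 1} (hA : IsSmoothForm A) :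
    IsSmoothFun (M.verticalCurvature A) :=
  isSmoothFun_quot (M.smooth_κ.wedge hA.extD) M.isSmoothForm_vol
    (fun _ _ hy => formRep_stdFrame_ne_zero M.vol_ne_zero hy) M.vol_ne_zero

theorem extD_add_smul_κ_apply {A : DiffForm X 1} (hA : IsSmoothForm A) {σ : X → ℝ}
    (hσ : IsSmoothFun σ) (x : X) (u v : E3) :
    extD (A + smulForm σ M.κ) x ![u, v] = extD A x ![u, v] +
      (σ x * extD M.κ x ![u, v] + funD σ x u * M.κ x ![v] - funD σ x v * M.κ x ![u]) := by
  rw [extD_add hA (M.smooth_κ.smulForm hσ), ← extD_smulForm_apply hσ M.smooth_κ]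
  rfl

/-- In `d(σκ) = dσ ∧ κ + σ dκ` the derivative of `σ` is killed by `κ`, so the equation for the lift
is algebraic in `σ`. -/
theorem κ_wedge_extD_add_smul_κ {A : DiffForm X 1} (hA : IsSmoothForm A) {σ : X → ℝ}
    (hσ : IsSmoothFun σ) :
    wedge M.κ (extD (A + smulForm σ M.κ)) = wedge M.κ (extD A) + smulForm σ M.vol := by
  funext x
  refine ext₃ fun u v w => ?_
  have h : (wedge M.κ (extD A) + smulForm σ M.vol) x ![u, v, w] =
      wedge M.κ (extD A) x ![u, v, w] + σ x * M.vol x ![u, v, w] := rfl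
  rw [h, vol_apply]
  simp only [wedge, wedgeOne_apply₃, M.extD_add_smul_κ_apply hA hσ]
  ring

theorem verticalCurvature_add_smul_κ {A : DiffForm X 1} (hA : IsSmoothForm A) {σ : X → ℝ}
    (hσ : IsSmoothFun σ) (x : X) :
    M.verticalCurvature (A + smulForm σ M.κ) x = M.verticalCurvature A x + σ x := by
  rw [verticalCurvature, M.κ_wedge_extD_add_smul_κ hA hσ, M.κ_wedge_extD]
  have h := M.vol_stdFrame_ne_zero x
  simp only [quot, smulForm, Pi.add_apply, ContinuousAlternatingMap.add_apply,
    ContinuousAlternatingMap.smul_apply, smul_eq_mul]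
  field_simp

theorem isSmoothForm_ruminLift {A : DiffForm X 1} (hA : IsSmoothForm A) :
    IsSmoothForm (M.ruminLift A) :=
  M.isSmoothForm_add_smul_κ hA (M.isSmoothFun_verticalCurvature hA).neg

theorem isRuminLift_ruminLift {A : DiffForm X 1} (hA : IsSmoothForm A) :
    M.IsRuminLift A (M.ruminLift A) := by
  refine ⟨M.isSmoothForm_ruminLift hA, fun x v hv => ?_, ?_⟩
  · change A x ![v] + -M.verticalCurvature A x * M.κ x ![v] = _
    rw [hv]
    ring
  · rw [ruminLift, M.κ_wedge_extD_add_smul_κ hA (M.isSmoothFun_verticalCurvature hA).neg,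
      M.κ_wedge_extD]
    funext x
    have h : ∀ (t : ℝ) (μ : E3 [⋀^Fin 3]→L[ℝ] ℝ), t • μ + -t • μ = 0 := fun t μ => by
      rw [← add_smul, add_neg_cancel, zero_smul]
    exact h _ _

/-- Agreement on `H` and `A(ξ) = 0` force `l = A + l(ξ)κ`; then `κ ∧ dl = 0` reads `f + l(ξ) = 0`.
-/
theorem eq_ruminLift {A l : DiffForm X 1} (hA : IsSmoothForm A) (hH : M.IsHorizontal A)
    (hl : M.IsRuminLift A l) : l = M.ruminLift A := by
  obtain ⟨hls, hlA, hlκ⟩ := hl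
  have hσ := isSmoothFun_apply hls M.smooth_ξ
  have hl' : l = A + smulForm (fun x => l x ![M.ξ x]) M.κ := by
    funext x
    refine ext₁ fun v => ?_
    change _ = A x ![v] + l x ![M.ξ x] * M.κ x ![v]
    have h0 : M.κ x ![v - M.κ x ![v] • M.ξ x] = 0 := by
      rw [oneForm_sub, oneForm_smul, M.κ_ξ]
      ring
    have h := hlA x _ h0
    rw [oneForm_sub, oneForm_smul, oneForm_sub, oneForm_smul, hH x] at h
    linarith
  rw [ruminLift]
  conv_lhs => rw [hl']
  congr 2
  funext x
  have hv := M.verticalCurvature_add_smul_κ hA hσ x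
  rw [← hl', verticalCurvature, hlκ] at hv
  rw [quot, Pi.zero_apply, ContinuousAlternatingMap.coe_zero, Pi.zero_apply, zero_div] at hv
  change _ = -M.verticalCurvature A x
  linarith

/-- `D¹A = ι_ξ dA + d_H f` for the function `f` with `κ ∧ dA = f (κ ∧ dκ)`. -/
theorem D1_apply {A : DiffForm X 1} (hA : IsSmoothForm A) (hH : M.IsHorizontal A) (x : X)
    (v : E3) : M.D1 A x ![v] = extD A x ![M.ξ x, v] +
      (funD (M.verticalCurvature A) x v -
        M.κ x ![v] * funD (M.verticalCurvature A) x (M.ξ x)) := by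
  have h : ∀ y w, M.starH₂ (M.dH A) y w = M.verticalCurvature A y := fun y w => by
    rw [starH₂_apply, κ_wedge_dH, verticalCurvature]
  change lieD M.ξ A x ![v] + M.dH (M.starH₂ (M.dH A)) x ![v] = _
  rw [lieD_apply M.smooth_ξ hA hH, dH, compContinuousLinearMap_apply₁, extD_ofFun h, projH_apply,
    map_sub, map_smul, smul_eq_mul]

theorem isHorizontal_D1 {A : DiffForm X 1} (hA : IsSmoothForm A) (hH : M.IsHorizontal A) :
    M.IsHorizontal (M.D1 A) := fun x => by
  rw [M.D1_apply hA hH, twoForm_self, M.κ_ξ]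
  ring

/-- The contact operator is the differential of Rumin's lift. -/
theorem D_eq_extD_ruminLift {A : DiffForm X 1} (hA : IsSmoothForm A) (hH : M.IsHorizontal A) :
    M.D A = extD (M.ruminLift A) := by
  funext x
  refine ext₂ fun u v => ?_
  rw [D, wedge, wedgeOne_apply₂, M.D1_apply hA hH, M.D1_apply hA hH, ruminLift,
    M.extD_add_smul_κ_apply hA (M.isSmoothFun_verticalCurvature hA).neg, funD_neg, funD_neg,
    Pi.neg_apply]
  -- Contraction of `κ ∧ dA = f κ ∧ dκ` with `ξ`: `dA - κ ∧ ι_ξ dA = f dκ`.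
  have h := M.κ_wedge_extD_apply A x (M.ξ x) u v
  rw [M.κ_ξ, M.dκ_ξ, M.dκ_ξ] at h
  linear_combination -h

variable [CompactSpace X] [T2Space X]

/-- Shift-invariance of the action. -/
theorem action_add_smul_κ {A : DiffForm X 1} (hA : IsSmoothForm A) {σ : X → ℝ}
    (hσ : IsSmoothFun σ) : M.action (A + smulForm σ M.κ) = M.action A := by
  have hs := M.isSmoothForm_add_smul_κ hA hσ
  have hac : ∀ {B : DiffForm X 1}, IsSmoothForm B → IsSmoothForm (wedge B (extD B)) :=
    fun hB => hB.wedge hB.extD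
  have hbc : ∀ {B : DiffForm X 1}, IsSmoothForm B →
      IsSmoothForm (smulForm (M.verticalCurvature B) (wedge M.κ (extD B))) :=
    fun hB => (M.smooth_κ.wedge hB.extD).smulForm (M.isSmoothFun_verticalCurvature hB)
  have hθ : IsSmoothForm (wedge (smulForm σ A) M.κ) := (hA.smulForm hσ).wedge M.smooth_κ
  -- The two integrands differ by the exact form `d(σA ∧ κ)`. The identity is arranged without
  -- subtraction, so that additivity of the integral suffices.
  have key : wedge (A + smulForm σ M.κ) (extD (A + smulForm σ M.κ)) +
      smulForm (M.verticalCurvature A) (wedge M.κ (extD A)) + extD (wedge (smulForm σ A) M.κ) =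
      wedge A (extD A) + smulForm (M.verticalCurvature (A + smulForm σ M.κ))
        (wedge M.κ (extD (A + smulForm σ M.κ))) := by
    funext x
    refine ext₃ fun u v w => ?_
    have h := M.κ_wedge_extD_apply A x u v w
    change wedge (A + smulForm σ M.κ) (extD (A + smulForm σ M.κ)) x ![u, v, w] +
      M.verticalCurvature A x * wedge M.κ (extD A) x ![u, v, w] +
      extD (wedge (smulForm σ A) M.κ) x ![u, v, w] = wedge A (extD A) x ![u, v, w] +
      M.verticalCurvature (A + smulForm σ M.κ) x *
        wedge M.κ (extD (A + smulForm σ M.κ)) x ![u, v, w]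
    have hA' : ∀ a, (A + smulForm σ M.κ) x ![a] = A x ![a] + σ x * M.κ x ![a] := fun _ => rfl
    have hσA : ∀ a, smulForm σ A x ![a] = σ x * A x ![a] := fun _ => rfl
    rw [M.verticalCurvature_add_smul_κ hA hσ, extD_wedge_apply (hA.smulForm hσ) M.smooth_κ]
    simp only [wedge, wedgeOne_apply₃, M.extD_add_smul_κ_apply hA hσ, hA', hσA,
      extD_smulForm_apply hσ hA]
    linear_combination σ x * h
  have hint := congrArg (integral M.vol) key
  have hv := M.isSmoothForm_vol
  rw [integral_add hv M.vol_ne_zero ((hac hs).add (hbc hA)) hθ.extD,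
    integral_add hv M.vol_ne_zero (hac hs) (hbc hA), integral_add hv M.vol_ne_zero (hac hA) (hbc hs),
    integral_extD hv M.vol_ne_zero hθ] at hint
  change integral M.vol _ - integral M.vol (smulForm (M.verticalCurvature _) _) =
    integral M.vol _ - integral M.vol (smulForm (M.verticalCurvature _) _)
  linarith

/-- Shift-invariance replaces `A` by `l(A)`, whose quadratic term is zero; in `l(A) ∧ dl(A)` the
summand `-fκ ∧ dl(A)` vanishes as well. -/
theorem action_eq_integral {A : DiffForm X 1} (hA : IsSmoothForm A) (hH : M.IsHorizontal A) :
    M.action A = integral M.vol (wedge A (M.D A)) := by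
  have hl := (M.isRuminLift_ruminLift hA).2.2
  rw [← M.action_add_smul_κ hA (M.isSmoothFun_verticalCurvature hA).neg,
    M.D_eq_extD_ruminLift hA hH]
  change M.action (M.ruminLift A) = _
  have h0 : ∀ τ : X → ℝ, smulForm τ (wedge M.κ (extD (M.ruminLift A))) = 0 := fun τ => by
    rw [hl]
    funext x
    exact smul_zero _
  rw [action, h0, integral_zero, sub_zero]
  congr 1
  funext x
  refine ext₃ fun u v w => ?_
  have h := congrArg (fun η : E3 [⋀^Fin 3]→L[ℝ] ℝ => η ![u, v, w]) (congrFun hl x)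
  have hA' : ∀ a, M.ruminLift A x ![a] = A x ![a] + -M.verticalCurvature A x * M.κ x ![a] :=
    fun _ => rfl
  simp only [wedge, wedgeOne_apply₃, hA', Pi.zero_apply,
    ContinuousAlternatingMap.coe_zero] at h ⊢
  linear_combination -M.verticalCurvature A x * h

/-- `D¹A` is horizontal, so the two horizontal stars cancel; the sign in the pairing is absorbed by
`-κ ∧ A ∧ D¹A = A ∧ κ ∧ D¹A`. -/
theorem innerκ_eq_integral {A : DiffForm X 1} (hA : IsSmoothForm A) (hH : M.IsHorizontal A) :
    M.innerκ A (-M.starH₁ (M.D1 A)) = integral M.vol (wedge A (M.D A)) := by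
  rw [innerκ, M.starH₁_neg_starH₁ (M.isHorizontal_D1 hA hH), ← integral_neg]
  congr 1
  funext x
  refine ext₃ fun u v w => ?_
  change -(wedge M.κ (wedge A (M.D1 A)) x ![u, v, w]) = _
  simp only [D, wedge, wedgeOne_apply₃, wedgeOne_apply₂]
  ring

end ContactMetricStructure

end ContactCS
end
open ContactCS in
theorem mainTheorem7 {X : Type*} [TopologicalSpace X] [ChartedSpace E3 X]
    [IsManifold (𝓡 3) ∞ X] [CompactSpace X] [T2Space X] (M : ContactMetricStructure X) :
    (∀ A : DiffForm X 1, IsSmoothForm A → ∀ σ : X → ℝ, ContMDiff (𝓡 3) 𝓘(ℝ, ℝ) ∞ σ →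
      M.action (A + smulForm σ M.κ) = M.action A) ∧
    ∀ A : DiffForm X 1, IsSmoothForm A → M.IsHorizontal A →
      M.action A = M.inner A (M.star₂ (M.D A)) ∧
      M.action A = M.innerκ A (-M.starH₁ (M.D1 A)) ∧
      (∃! l : DiffForm X 1, M.IsRuminLift A l) ∧
      ∀ l : DiffForm X 1, M.IsRuminLift A l → M.D A = extD l := by
  refine ⟨fun A hA σ hσ => M.action_add_smul_κ hA (isSmoothFun_of_contMDiff hσ),
    fun A hA hH => ⟨?_, ?_, ⟨M.ruminLift A, M.isRuminLift_ruminLift hA,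
      fun l hl => M.eq_ruminLift hA hH hl⟩, fun l hl => ?_⟩⟩
  · rw [ContactMetricStructure.inner, M.star₁_star₂, M.action_eq_integral hA hH]
  · rw [M.innerκ_eq_integral hA hH, M.action_eq_integral hA hH]
  · rw [M.eq_ruminLift hA hH hl, M.D_eq_extD_ruminLift hA hH]
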